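/- All graphs here have a fixed finite vertex set $V$, no loops, and at most one edge between two vertices; an edge is either an arrow $a\to b$ or a line $a-b$. A *semi-directed cycle* is a sequence $(v_0,\dots,v_k)$ with $k\ge 3$, $v_0=v_k$, $v_0,\dots,v_{k-1}$ distinct, such that for each $i=1,\dots,k$ the graph contains $v_{i-1}\to v_i$ or $v_{i-1}-v_i$, with $v_{i-1}\to v_i$ for at least one $i$. A graph is *adicyclic*, or a *chain graph*, if it has no semi-directed cycle. A *triplex* $(\{a,c\},b)$ is an induced subgraph $a\to b\leftarrow c$, $a\to b-c$ or $a-b\leftarrow c$; a *2-biflag* $[a,b;c,d]$ is a subgraph $a\to c-d\leftarrow b$ in which $a,d$ are not adjacent and $b,c$ are not adjacent. The *augmented graph* $G^a$ is the undirected graph obtained from $G$ by replacing all arrows by lines, joining $a$ and $c$ for each triplex $(\{a,c\},b)$, and joining $a$ and $b$ for each 2-biflag $[a,b;c,d]$. For $S\subseteq V$ let $\mathrm{An}(S)$ be the set of vertices with a directed path of length $\ge 0$ to a vertex of $S$, let $\mathrm{Co}(S)$ be the set of vertices joined to a vertex of $S$ by a path of lines of length $\ge 0$, and let $G[S]$ consist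 of the subgraph of $G$ induced by $\mathrm{An}(S)$ together with all lines of $G$ between vertices of $\mathrm{Co}(\mathrm{An}(S))$. A probability distribution $P$ on a product $\prod_{v\in V}X_v$ of standard Borel spaces is *AMP (Andersson–Madigan–Perlman) Markov* with respect to $G$ if $X_A\perp\!\!\!\perp X_B\mid X_C$ under $P$ for all pairwise disjoint $A,B,C\subseteq V$ such that $C$ separates $A$ from $B$ in $(G[A\cup B\cup C])^a$. Let $\mathcal P(G)$ be the set of these distributions. Two graphs $G,H$ are *(AMP) Markov equivalent* if $\mathcal P(G)=\mathcal P(H)$ on every such product space. The *AMP Markov equivalence class* of a chain graph $G_0$ is the set of all chain graphs that are Markov equivalent to $G_0$. For an AMP Markov equivalence class $\mathcal G$, the *AMP essential graph* $\mathcal G^*$ is the graph on $V$ that contains the arrow $a\to b$ iff $a\to b$ occurs in some $G\in\mathcal G$ and $a\leftarrow b$ occurs in no $G\in\mathcal G$, and contains the line $a-b$ iff either $a-b$ occurs in every $G\in\mathcal G$, or $a\to b$ occurs in some $G\in\mathcal G$ and $a\leftarrow b$ occurs in some $G'\in\mathcal G$. **Theorem 3.2.** For every AMP Markov equivalence class $\mathcal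 G$ of chain graphs on $V$, the essential graph $\mathcal G^*$ has the same skeleton as (i.e. the same pairs of adjacent vertices as) each $G\in\mathcal G$, is adicyclic (i.e. is a chain graph), and belongs to $\mathcal G$; so it is Markov equivalent to every $G\in\mathcal G$. Consequently $\mathcal G^*$ uniquely represents $\mathcal G$: for AMP Markov equivalence classes $\mathcal G_1,\mathcal G_2$ of chain graphs on $V$, $\mathcal G_1=\mathcal G_2$ if and only if $\mathcal G_1^*=\mathcal G_2^*$. -/

import Mathlib

open MeasureTheory ProbabilityTheory

/-- A graph with directed and undirected edges, at most one edge between two vertices and no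
loops, coded by its edge set `E ⊆ {(a, b) | a ≠ b}`: the pair `(a, b)` alone is an arrow `a → b`,
and both pairs `(a, b)`, `(b, a)` together are a line `a - b`. Thus `Edge a b` says
"`a → b` or `a - b`". -/
@[ext]
structure MixedGraph (V : Type*) where
  Edge : V → V → Prop
  irrefl : ∀ a, ¬ Edge a a

namespace MixedGraph

variable {V : Type*}

/-- `a → b`. -/
def Arrow (G : MixedGraph V) (a b : V) : Prop := G.Edge a b ∧ ¬ G.Edge b a

/-- `a - b`. -/
def Line (G : MixedGraph V) (a b : V) : Prop := G.Edge a b ∧ G.Edge b a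

/-- `a` and `b` are joined by an arrow (of either orientation) or a line. -/
def Adj (G : MixedGraph V) (a b : V) : Prop := G.Edge a b ∨ G.Edge b a

def SameSkeleton (G H : MixedGraph V) : Prop := ∀ a b, G.Adj a b ↔ H.Adj a b

/-- `(v 0, …, v k)` is a semi-directed cycle: `k ≥ 3`, `v 0 = v k`, the vertices
`v 0, …, v (k - 1)` are distinct, each step is an arrow forward or a line, and at least one step
is an arrow. -/
def IsSemidirectedCycle (G : MixedGraph V) (k : ℕ) (v : ℕ → V) : Prop :=
  3 ≤ k ∧ v 0 = v k ∧ Set.InjOn v (Set.Iio k) ∧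
    (∀ i < k, G.Edge (v i) (v (i + 1))) ∧ ∃ i < k, G.Arrow (v i) (v (i + 1))

/-- A chain graph, i.e. an adicyclic graph: one without semi-directed cycles. -/
def IsChainGraph (G : MixedGraph V) : Prop := ∀ k v, ¬ G.IsSemidirectedCycle k v

/-- The triplex `({a, c}, b)`: one of `a → b ← c`, `a → b - c`, `a - b ← c` is an induced
subgraph. -/
def Triplex (G : MixedGraph V) (a b c : V) : Prop :=
  a ≠ c ∧ ¬ G.Adj a c ∧ G.Edge a b ∧ G.Edge c b ∧ (G.Arrow a b ∨ G.Arrow c b)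

/-- The 2-biflag `[a, b; c, d]`: `a → c - d ← b`, with `a, d` not adjacent and `b, c` not
adjacent; `a` and `b` may or may not be adjacent. -/
def Biflag (G : MixedGraph V) (a b c d : V) : Prop :=
  G.Arrow a c ∧ G.Line c d ∧ G.Arrow b d ∧ ¬ G.Adj a d ∧ ¬ G.Adj b c

/-- The augmented graph `G^a`: all arrows become lines, and each triplex `({a, c}, b)` and each
2-biflag `[a, b; c, d]` is made complete. -/
def augmented (G : MixedGraph V) : SimpleGraph V :=
  SimpleGraph.fromRel fun a b =>
    G.Adj a b ∨ (∃ c, G.Triplex a c b) ∨ ∃ c d, G.Biflag a b c d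

/-- `An(A)`: the vertices with a directed path (of length `≥ 0`) into `A`. -/
def ancestors (G : MixedGraph V) (A : Set V) : Set V :=
  {v | ∃ a ∈ A, Relation.ReflTransGen G.Arrow v a}

/-- `Co(A)`: the union of the chain components that meet `A`. -/
def coherent (G : MixedGraph V) (A : Set V) : Set V :=
  {v | ∃ a ∈ A, Relation.ReflTransGen G.Line v a}

/-- The extended subgraph `G[A]`: the subgraph induced on `An(A)`, together with all lines
within `Co(An(A))`. (Vertices outside `Co(An(A))` are kept, as isolated vertices.) -/
def extended (G : MixedGraph V) (A : Set V) : MixedGraph V where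
  Edge a b :=
    (G.Edge a b ∧ a ∈ G.ancestors A ∧ b ∈ G.ancestors A) ∨
      (G.Line a b ∧ a ∈ G.coherent (G.ancestors A) ∧ b ∈ G.coherent (G.ancestors A))
  irrefl a := by
    rintro (⟨h, -⟩ | ⟨⟨h, -⟩, -⟩) <;> exact G.irrefl a h

/-- `C` separates `A` from `B` in the undirected graph `U`. -/
def Separates (U : SimpleGraph V) (A B C : Set V) : Prop :=
  ∀ a ∈ A, ∀ b ∈ B, ∀ p : U.Walk a b, ∃ c ∈ C, c ∈ p.support

/-- `X_A ⫫ X_B | X_C` under `P`, for the coordinate maps on a product space. -/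
def CondIndepCoord [Finite V] {X : V → Type} [∀ v, MeasurableSpace (X v)]
    [∀ v, StandardBorelSpace (X v)] (P : ProbabilityMeasure (∀ v, X v)) (A B C : Set V) : Prop :=
  CondIndepFun (MeasurableSpace.comap (C.domRestrict (π := X)) inferInstance)
    (Set.measurable_restrict C).comap_le (A.domRestrict (π := X)) (B.domRestrict (π := X))
    (P : Measure (∀ v, X v))

/-- `𝒫(G)` on the product space `∏ v, X v`: the probability distributions with the (global)
Andersson–Madigan–Perlman Markov property of `G`, i.e. `X_A ⫫ X_B | X_C` whenever `C` separates
`A` from `B` in the augmented graph of the extended subgraph `G[A ∪ B ∪ C]`. -/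
def ampModel [Finite V] (G : MixedGraph V) (X : V → Type) [∀ v, MeasurableSpace (X v)]
    [∀ v, StandardBorelSpace (X v)] : Set (ProbabilityMeasure (∀ v, X v)) :=
  {P | ∀ A B C : Set V, Disjoint A B → Disjoint A C → Disjoint B C →
    Separates (G.extended (A ∪ B ∪ C)).augmented A B C → CondIndepCoord P A B C}

/-- AMP Markov equivalence: `𝒫(G) = 𝒫(H)`, on every product of standard Borel spaces. -/
def MarkovEquiv [Finite V] (G H : MixedGraph V) : Prop :=
  ∀ (X : V → Type) [∀ v, MeasurableSpace (X v)] [∀ v, StandardBorelSpace (X v)],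
    G.ampModel X = H.ampModel X

/-- `𝒢` is the AMP Markov equivalence class of some chain graph. -/
def IsMarkovClass [Finite V] (𝒢 : Set (MixedGraph V)) : Prop :=
  ∃ G₀ : MixedGraph V, G₀.IsChainGraph ∧ 𝒢 = {G | G.IsChainGraph ∧ MarkovEquiv G G₀}

/-- `a → b` occurs in some member of `𝒢`, and `a ← b` in none. -/
def EssentialArrow (𝒢 : Set (MixedGraph V)) (a b : V) : Prop :=
  (∃ G ∈ 𝒢, G.Arrow a b) ∧ ∀ G ∈ 𝒢, ¬ G.Arrow b a

/-- `a - b` occurs in every member of `𝒢`, or `a → b` and `a ← b` both occur in members. -/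
def EssentialLine (𝒢 : Set (MixedGraph V)) (a b : V) : Prop :=
  (∀ G ∈ 𝒢, G.Line a b) ∨ ((∃ G ∈ 𝒢, G.Arrow a b) ∧ ∃ G ∈ 𝒢, G.Arrow b a)

/-- The AMP essential graph `𝒢*`. The clause `a ≠ b` matters only for empty `𝒢`. -/
def essentialGraph (𝒢 : Set (MixedGraph V)) : MixedGraph V where
  Edge a b := a ≠ b ∧ (EssentialArrow 𝒢 a b ∨ EssentialLine 𝒢 a b)
  irrefl _ h := h.1 rfl

theorem EssentialLine.symm {𝒢 : Set (MixedGraph V)} {a b : V} (h : EssentialLine 𝒢 a b) :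
    EssentialLine 𝒢 b a :=
  h.imp (fun h G hG => (h G hG).symm) And.symm

/-- The arrows of `𝒢*` are the essential arrows. -/
theorem essentialGraph_arrow (𝒢 : Set (MixedGraph V)) (a b : V) :
    (essentialGraph 𝒢).Arrow a b ↔ EssentialArrow 𝒢 a b := by
  constructor
  · rintro ⟨⟨hne, h | h⟩, h'⟩
    · exact h
    · exact absurd ⟨hne.symm, Or.inr h.symm⟩ h'
  · rintro ⟨⟨G, hG, hab⟩, h⟩
    refine ⟨⟨?_, Or.inl ⟨⟨G, hG, hab⟩, h⟩⟩, ?_⟩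
    · rintro rfl
      exact hab.2 hab.1
    · rintro ⟨-, h' | h' | h'⟩
      · exact h'.2 G hG hab
      · exact hab.2 (h' G hG).1
      · obtain ⟨⟨G', hG', h''⟩, -⟩ := h'
        exact h G' hG' h''

/-- The lines of `𝒢*` are the essential lines. -/
theorem essentialGraph_line {𝒢 : Set (MixedGraph V)} (h𝒢 : 𝒢.Nonempty) (a b : V) :
    (essentialGraph 𝒢).Line a b ↔ EssentialLine 𝒢 a b := by
  constructor
  · rintro ⟨⟨-, h | h⟩, h'⟩
    · exact absurd h' ((essentialGraph_arrow 𝒢 a b).2 h).2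
    · exact h
  · intro h
    have hne : a ≠ b := by
      rintro rfl
      obtain ⟨G, hG⟩ := h𝒢
      rcases h with h | ⟨⟨G', -, h⟩, -⟩
      · exact G.irrefl a (h G hG).1
      · exact h.2 h.1
    exact ⟨⟨hne, Or.inr h⟩, ⟨hne.symm, Or.inr h.symm⟩⟩

end MixedGraph

/-! ### Walks, geodesics and chain graphs -/

namespace MixedGraph

variable {V : Type*} {G H : MixedGraph V} {a b c d : V}

/-! Markov equivalence of chain graphs is the same as having the same skeleton and the same
triplexes (`markovEquiv_iff`). The class is thereby a combinatorial object, and it remains to see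
that its essential graph has the common skeleton and triplexes and is adicyclic.

Adicyclicity is the hard point. A shortest semi-directed cycle of the essential graph has no chord.
If its length is at least 4, take a member containing one arrow of the cycle: since no new triplex
may appear, that arrow forces all further edges of the cycle, and the member is not a chain graph.
In length 3 the cycle leads to a triangle with one fixed arrow and two reversible edges
(`essentialGraph_not_triangle`). To exclude it, one passes to the directed members, whose lines are
lines in every member. They arise by orienting the lines of one member as in another (`refine`). Two
of them differ only in the direction of arrows, a vertex at a reversible arrow has no lines
(`Reversible.not_line`), and, as for acyclic digraphs, one is turned into the other by reversing
covered arrows (`exists_covered`). A descent by such reversals rules out the triangle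
(`not_badTriangle`).

For the Markov property, separation in the augmented graph is first rewritten as the absence of an
open route (`separates_iff`). The basic move is the split: the lines between a set and its
complement become arrows into the set. Under mild conditions it preserves triplexes and the
existence of open routes (`Splittable.routeEquiv`). Splits lead from any member to a directed one,
and the reversal of a covered arrow is a split undone and another one made; so all members have the
same separations. Conversely, a fair coin shown by two adjacent vertices, or by the three vertices
of an unshielded path that is not a triplex, gives a distribution that detects the skeleton and the
triplexes. -/

/-- `b` can be reached from `a` along arrows (forward) and lines. -/
def Reach (G : MixedGraph V) : V → V → Prop := Relation.ReflTransGen G.Edge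

theorem Reach.refl (a : V) : G.Reach a a := Relation.ReflTransGen.refl

theorem Reach.trans (h : G.Reach a b) (h' : G.Reach b c) : G.Reach a c :=
  Relation.ReflTransGen.trans h h'

theorem Edge.reach (h : G.Edge a b) : G.Reach a b := Relation.ReflTransGen.single h

theorem Adj.symm (h : G.Adj a b) : G.Adj b a := Or.symm h

theorem Line.symm (h : G.Line a b) : G.Line b a := And.symm h

theorem Arrow.adj (h : G.Arrow a b) : G.Adj a b := Or.inl h.1

theorem Line.adj (h : G.Line a b) : G.Adj a b := Or.inl h.1

theorem Edge.adj (h : G.Edge a b) : G.Adj a b := Or.inl h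

theorem Edge.ne (h : G.Edge a b) : a ≠ b := by
  rintro rfl
  exact G.irrefl a h

theorem Adj.ne (h : G.Adj a b) : a ≠ b := by
  rintro rfl
  exact h.elim (G.irrefl a) (G.irrefl a)

/-- A sequence of `n` consecutive `r`-steps from `a` to `b`. -/
def StepsTo (r : V → V → Prop) (b : V) : ℕ → V → Prop
  | 0, a => a = b
  | n + 1, a => ∃ c, r a c ∧ StepsTo r b n c

theorem exists_stepsTo {r : V → V → Prop} (h : Relation.ReflTransGen r a b) :
    ∃ n, StepsTo r b n a := by
  induction h using Relation.ReflTransGen.head_induction_on with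
  | refl => exact ⟨0, rfl⟩
  | head h _ ih =>
    obtain ⟨n, hn⟩ := ih
    exact ⟨n + 1, _, h, hn⟩

theorem exists_path_of_min_steps {r : V → V → Prop} {b : V} (n : ℕ) :
    ∀ a, StepsTo r b n a → (∀ m < n, ¬ StepsTo r b m a) →
    ∃ v : ℕ → V, v 0 = a ∧ (∀ i < n, r (v i) (v (i + 1))) ∧
      ∀ i ≤ n, StepsTo r b (n - i) (v i) ∧ ∀ m < n - i, ¬ StepsTo r b m (v i) := by
  induction n with
  | zero =>
    intro a h _
    refine ⟨fun _ => a, rfl, by simp, fun i hi => ?_⟩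
    obtain rfl : i = 0 := by omega
    exact ⟨h, by simp⟩
  | succ n ih =>
    rintro a ⟨c, hac, hc⟩ hmin
    obtain ⟨v, hv0, hv, hv'⟩ := ih c hc fun m hm h => hmin (m + 1) (by omega) ⟨c, hac, h⟩
    refine ⟨fun i => Nat.casesOn i a v, rfl, ?_, ?_⟩
    · rintro (_ | i) hi
      · simpa [hv0] using hac
      · exact hv i (by omega)
    · rintro (_ | i) hi
      · exact ⟨⟨c, hac, hc⟩, fun m hm => hmin m (by omega)⟩
      · simpa using hv' i (by omega)

/-- A shortest path is free of forward chords and of repeated vertices. -/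
theorem exists_geodesic {r : V → V → Prop} (h : Relation.ReflTransGen r a b) :
    ∃ (k : ℕ) (v : ℕ → V), v 0 = a ∧ v k = b ∧ (∀ i < k, r (v i) (v (i + 1))) ∧
      (∀ i j, i < j → j ≤ k → r (v i) (v j) → j = i + 1) ∧
      ∀ i j, i ≤ k → j ≤ k → v i = v j → i = j := by
  classical
  have hex := exists_stepsTo h
  obtain ⟨v, hv0, hv, hv'⟩ := exists_path_of_min_steps (Nat.find hex) a (Nat.find_spec hex)
    fun m hm => Nat.find_min hex hm
  refine ⟨Nat.find hex, v, hv0, ?_, hv, ?_, ?_⟩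
  · simpa [StepsTo] using (hv' _ le_rfl).1
  · intro i j hij hj hr
    by_contra hne
    exact (hv' i (by omega)).2 (Nat.find hex - j + 1) (by omega) ⟨_, hr, (hv' j hj).1⟩
  · intro i j hi hj hij
    by_contra hne
    rcases lt_or_gt_of_ne hne with hlt | hlt
    · exact (hv' i hi).2 (Nat.find hex - j) (by omega) (hij ▸ (hv' j hj).1)
    · exact (hv' j hj).2 (Nat.find hex - i) (by omega) (hij ▸ (hv' i hi).1)

theorem reach_of_steps {v : ℕ → V} {k : ℕ} (h : ∀ i < k, G.Edge (v i) (v (i + 1))) {i j : ℕ}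
    (hij : i ≤ j) (hj : j ≤ k) : G.Reach (v i) (v j) := by
  induction j, hij using Nat.le_induction with
  | base => exact Reach.refl _
  | succ j hij ih => exact (ih (by omega)).trans (Edge.reach (h j (by omega)))

/-- Replaces cycles by reachability, where repeated vertices do not matter. If `G.Edge b a` fails, a
geodesic from `b` back to `a` has length at least 2, and the arrow closes it to a semi-directed
cycle. -/
theorem isChainGraph_iff :
    G.IsChainGraph ↔ ∀ a b, G.Edge a b → G.Reach b a → G.Edge b a := by
  constructor
  · intro hG a b hab hba
    by_contra hn
    obtain ⟨k, v, h0, hk, hv, -, hinj⟩ := exists_geodesic hba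
    have hk2 : 2 ≤ k := by
      rcases k with _ | _ | k
      · exact absurd (h0.symm.trans hk) hab.ne.symm
      · exact absurd (by simpa [h0, hk] using hv 0 (by omega)) hn
      · omega
    refine hG (k + 1) (fun i => Nat.casesOn i a v) ⟨by omega, hk.symm, ?_, ?_, 0, by omega, ?_⟩
    · rintro (_ | i) hi (_ | j) hj hij
      · rfl
      · have := hinj k j le_rfl (by simp at hj; omega) (hk.trans hij)
        simp at hj; omega
      · have := hinj i k (by simp at hi; omega) le_rfl (hij.trans hk.symm)
        simp at hi; omega
      · have := hinj i j (by simp at hi; omega) (by simp at hj; omega) hij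
        omega
    · rintro (_ | i) hi
      · simpa [h0] using hab
      · exact hv i (by omega)
    · subst h0
      exact ⟨hab, hn⟩
  · rintro h k v ⟨-, h0, -, hv, i, hi, hab⟩
    refine hab.2 (h _ _ hab.1 ?_)
    have h1 := reach_of_steps hv (i := i + 1) (j := k) (by omega) le_rfl
    have h2 := reach_of_steps hv (i := 0) (j := i) (by omega) (by omega)
    rw [← h0] at h1
    exact h1.trans h2

namespace IsChainGraph

theorem edge_symm (hG : G.IsChainGraph) (h : G.Edge a b) (h' : G.Reach b a) : G.Edge b a :=
  isChainGraph_iff.1 hG a b h h'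

theorem not_reach (hG : G.IsChainGraph) (h : G.Arrow a b) : ¬ G.Reach b a :=
  fun h' => h.2 (hG.edge_symm h.1 h')

theorem edge_of_reach (hG : G.IsChainGraph) (h : G.Adj a b) (h' : G.Reach a b) : G.Edge a b :=
  h.elim id fun h => hG.edge_symm h h'

theorem edge_trans (hG : G.IsChainGraph) (h : G.Edge a b) (h' : G.Edge b c) (hac : G.Adj a c) :
    G.Edge a c :=
  hG.edge_of_reach hac ((Edge.reach h).trans (Edge.reach h'))

theorem arrow_trans_left (hG : G.IsChainGraph) (h : G.Arrow a b) (h' : G.Edge b c)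
    (hac : G.Adj a c) : G.Arrow a c :=
  ⟨hG.edge_trans h.1 h' hac, fun h'' => hG.not_reach h ((Edge.reach h').trans (Edge.reach h''))⟩

theorem arrow_trans_right (hG : G.IsChainGraph) (h : G.Edge a b) (h' : G.Arrow b c)
    (hac : G.Adj a c) : G.Arrow a c :=
  ⟨hG.edge_trans h h'.1 hac, fun h'' => hG.not_reach h' ((Edge.reach h'').trans (Edge.reach h))⟩

theorem line_trans (hG : G.IsChainGraph) (h : G.Line a b) (h' : G.Line b c) (hac : G.Adj a c) :
    G.Line a c :=
  ⟨hG.edge_trans h.1 h'.1 hac, hG.edge_trans h'.2 h.2 hac.symm⟩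

/-- On a closed walk all edges are lines. -/
theorem edge_symm_of_closed (hG : G.IsChainGraph) (h : G.Reach a b) (h' : G.Reach b a)
    (hne : a ≠ b) : ∃ c, G.Line a c := by
  rcases Relation.ReflTransGen.cases_head h with rfl | ⟨c, hac, hcb⟩
  · exact absurd rfl hne
  · exact ⟨c, hac, hG.edge_symm hac (Reach.trans hcb h')⟩

end IsChainGraph

/-! ### Triplex equivalence, refinement and directed members -/

theorem adj_iff_arrow_or_line : G.Adj a b ↔ G.Arrow a b ∨ G.Line a b ∨ G.Arrow b a := by
  unfold Adj Arrow Line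
  tauto

/-- The same skeleton and the same triplexes. -/
def TriplexEquiv (G H : MixedGraph V) : Prop :=
  SameSkeleton G H ∧ ∀ a b c, G.Triplex a b c ↔ H.Triplex a b c

theorem TriplexEquiv.refl (G : MixedGraph V) : TriplexEquiv G G :=
  ⟨fun _ _ => Iff.rfl, fun _ _ _ => Iff.rfl⟩

theorem TriplexEquiv.symm (h : TriplexEquiv G H) : TriplexEquiv H G :=
  ⟨fun a b => (h.1 a b).symm, fun a b c => (h.2 a b c).symm⟩

theorem TriplexEquiv.trans {K : MixedGraph V} (h : TriplexEquiv G H) (h' : TriplexEquiv H K) :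
    TriplexEquiv G K :=
  ⟨fun a b => (h.1 a b).trans (h'.1 a b), fun a b c => (h.2 a b c).trans (h'.2 a b c)⟩

theorem Triplex.symm (h : G.Triplex a b c) : G.Triplex c b a :=
  ⟨h.1.symm, fun h' => h.2.1 h'.symm, h.2.2.2.1, h.2.2.1, h.2.2.2.2.symm⟩

/-- In an unshielded triple `(a, b, c)` of `G`, an arrow out of the middle vertex of an equivalent
graph excludes a triplex. -/
theorem TriplexEquiv.adj_of_edges (h : TriplexEquiv G H) (hab : G.Edge a b) (hcb : G.Edge c b)
    (harr : G.Arrow a b ∨ G.Arrow c b) (hne : a ≠ c) (hba : ¬ H.Edge a b ∨ ¬ H.Edge c b) :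
    G.Adj a c := by
  by_contra hn
  have := (h.2 a b c).1 ⟨hne, hn, hab, hcb, harr⟩
  exact hba.elim (fun h => h this.2.2.1) fun h => h this.2.2.2.1

/-- The lines of `G` are refined by the edges of `H`; the arrows of `G` are kept. -/
def refine (G H : MixedGraph V) : MixedGraph V where
  Edge a b := G.Edge a b ∧ (H.Edge a b ∨ ¬ G.Edge b a)
  irrefl a h := G.irrefl a h.1

theorem refine_adj (h : SameSkeleton G H) : (G.refine H).Adj a b ↔ G.Adj a b := by
  have := h a b
  simp only [Adj, refine] at *
  tauto

theorem Reach.mono (hle : ∀ a b, G.Edge a b → H.Edge a b) (h : G.Reach a b) : H.Reach a b :=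
  Relation.ReflTransGen.mono hle _ _ h

/-- On a closed walk of the refinement all edges are lines of `G`, so they follow `H`; then the walk
is closed in `H`, and its edges are lines there too. -/
theorem IsChainGraph.refine (hG : G.IsChainGraph) (hH : H.IsChainGraph) :
    (G.refine H).IsChainGraph := by
  rw [isChainGraph_iff]
  intro a b hab hba
  have key : ∀ x, (G.refine H).Reach b x → (G.refine H).Reach x a → H.Reach b x := by
    intro x hbx
    induction hbx with
    | refl => intro _; exact Reach.refl _
    | @tail y z hby hyz ih =>
      intro hza
      have hyz' : (G.refine H).Edge y z := hyz
      have hzy : G.Edge z y := by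
        refine hG.edge_symm hyz'.1 (Reach.mono (G := G.refine H) (fun _ _ h => h.1) ?_)
        exact hza.trans ((Edge.reach hab).trans hby)
      exact (ih ((Edge.reach hyz').trans hza)).trans
        (Edge.reach (hyz'.2.resolve_right (not_not.2 hzy)))
  have h1 : G.Edge b a := hG.edge_symm hab.1 (Reach.mono (G := G.refine H) (fun _ _ h => h.1) hba)
  have h2 : H.Edge a b := hab.2.resolve_right (not_not.2 h1)
  exact ⟨h1, Or.inl (hH.edge_symm h2 (key a hba (Reach.refl _)))⟩

/-- At a triplex of `G` the edges of `H` also lead to the middle vertex, so it survives. A new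
triplex could only come from two lines of `G` and would be a triplex of `H`. -/
theorem TriplexEquiv.refine (h : TriplexEquiv G H) : TriplexEquiv (G.refine H) G := by
  refine ⟨fun a b => refine_adj h.1, fun a b c => ?_⟩
  have hac := refine_adj (a := a) (b := c) h.1
  have hab := h.1 a b
  have hcb := h.1 c b
  have ht := h.2 a b c
  have hac' := h.1 a c
  simp only [Triplex, hac] at *
  simp only [Adj, Arrow, MixedGraph.refine] at *
  grind

theorem refine_arrow_of_arrow (h : G.Arrow a b) : (G.refine H).Arrow a b :=
  ⟨⟨h.1, Or.inr h.2⟩, fun h' => h.2 h'.1⟩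

theorem refine_line (h : SameSkeleton G H) :
    (G.refine H).Line a b ↔ G.Line a b ∧ H.Line a b := by
  have := h a b
  simp only [Line, Adj, refine] at *
  tauto

/-- The chain graphs with the skeleton and the triplexes of `G₀`. -/
def triplexClass (G₀ : MixedGraph V) : Set (MixedGraph V) :=
  {G | G.IsChainGraph ∧ TriplexEquiv G G₀}

/-- The members of the class whose lines are lines in all members. -/
def directedMembers (G₀ : MixedGraph V) : Set (MixedGraph V) :=
  {D | D ∈ triplexClass G₀ ∧ ∀ a b, D.Line a b → ∀ G ∈ triplexClass G₀, G.Line a b}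

section Classes

variable {G₀ D E : MixedGraph V}

theorem triplexEquiv_of_mem (hG : G ∈ triplexClass G₀) (hH : H ∈ triplexClass G₀) :
    TriplexEquiv G H :=
  hG.2.trans hH.2.symm

theorem mem_triplexClass_of_equiv (hG : G ∈ triplexClass G₀) (hH : H.IsChainGraph)
    (h : TriplexEquiv H G) : H ∈ triplexClass G₀ :=
  ⟨hH, h.trans hG.2⟩

theorem refine_mem (hG : G ∈ triplexClass G₀) (hH : H ∈ triplexClass G₀) :
    G.refine H ∈ triplexClass G₀ :=
  mem_triplexClass_of_equiv hG (hG.1.refine hH.1)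
    (triplexEquiv_of_mem hG hH).refine

theorem refine_mem_directed (hG : G ∈ triplexClass G₀) (hD : D ∈ directedMembers G₀) :
    G.refine D ∈ directedMembers G₀ :=
  ⟨refine_mem hG hD.1, fun a b h =>
    hD.2 a b ((refine_line (triplexEquiv_of_mem hG hD.1).1).1 h).2⟩

instance [Finite V] : Finite (MixedGraph V) :=
  Finite.of_injective (fun G : MixedGraph V => G.Edge) fun _ _ h => MixedGraph.ext h

/-- A member with the fewest lines will do: refining it by a member in which one of its lines is an
arrow would lose that line. -/
theorem directedMembers_nonempty [Finite V] (hG : G ∈ triplexClass G₀) :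
    ∃ D, D ∈ directedMembers G₀ := by
  obtain ⟨D, hD, hmin⟩ := Set.exists_min_image (triplexClass G₀)
    (fun G => Set.ncard {p : V × V | G.Line p.1 p.2}) (Set.toFinite _) ⟨G, hG⟩
  refine ⟨D, hD, fun a b hab H hH => ?_⟩
  by_contra hn
  refine absurd (hmin _ (refine_mem hD hH)) (not_le.2 (Set.ncard_lt_ncard ?_ (Set.toFinite _)))
  have hl := fun a b => refine_line (a := a) (b := b) (triplexEquiv_of_mem hD hH).1
  refine Set.ssubset_iff_of_subset (fun p hp => ((hl _ _).1 hp).1) |>.2 ⟨(a, b), hab, fun h => ?_⟩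
  exact hn ((hl _ _).1 h).2

theorem line_iff_of_directed (hD : D ∈ directedMembers G₀) (hE : E ∈ directedMembers G₀) :
    D.Line a b ↔ E.Line a b :=
  ⟨fun h => hD.2 a b h E hE.1, fun h => hE.2 a b h D hD.1⟩

/-- An arrow of one directed member is an arrow, of one or the other orientation, in the
other ones. -/
theorem arrow_or_arrow (hD : D ∈ directedMembers G₀) (hE : E ∈ directedMembers G₀)
    (h : D.Arrow a b) : E.Arrow a b ∨ E.Arrow b a := by
  have h1 := adj_iff_arrow_or_line.1 (((triplexEquiv_of_mem hD.1 hE.1).1 a b).1 h.adj)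
  rcases h1 with h1 | h1 | h1
  · exact Or.inl h1
  · exact absurd ((line_iff_of_directed hD hE).2 h1).2 h.2
  · exact Or.inr h1

/-- `a → b` and `a ← b` both occur in directed members. -/
def Reversible (G₀ : MixedGraph V) (a b : V) : Prop :=
  (∃ D ∈ directedMembers G₀, D.Arrow a b) ∧ ∃ D ∈ directedMembers G₀, D.Arrow b a

theorem Reversible.symm (h : Reversible G₀ a b) : Reversible G₀ b a := And.symm h

end Classes

/-! ### Splits, covered arrows and their reversal -/

/-- The lines between `T` and its complement become arrows into `T`. -/
def split (G : MixedGraph V) (T : Set V) : MixedGraph V where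
  Edge a b := G.Edge a b ∧ ¬ (a ∈ T ∧ b ∉ T ∧ G.Edge b a)
  irrefl a h := G.irrefl a h.1

/-- The conditions under which `split` changes no triplex. -/
structure Splittable (G : MixedGraph V) (T : Set V) : Prop where
  joined : ∀ q ∉ T, ∀ t ∈ T, G.Line q t → ∀ t' ∈ T, G.Line q t'
  complete : ∀ q ∉ T, ∀ q' ∉ T, ∀ t ∈ T, G.Line q t → G.Line q' t → q ≠ q' → G.Line q q'
  parents : ∀ p, ∀ q ∉ T, ∀ t ∈ T, G.Arrow p q → G.Line q t → G.Arrow p t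

theorem split_adj {T : Set V} : (G.split T).Adj a b ↔ G.Adj a b := by
  simp only [Adj, split]
  tauto

/-- A closed walk consists of lines of `G`, and in the split no such line leads out of `T`; so a
walk that enters `T` cannot close up outside. -/
theorem IsChainGraph.split (hG : G.IsChainGraph) (T : Set V) : (G.split T).IsChainGraph := by
  rw [isChainGraph_iff]
  intro a b hab hba
  have h1 : G.Edge b a := hG.edge_symm hab.1 (Reach.mono (G := G.split T) (fun _ _ h => h.1) hba)
  refine ⟨h1, ?_⟩
  rintro ⟨hb, ha, -⟩
  have key : ∀ x, (G.split T).Reach b x → (G.split T).Reach x a → x ∈ T := by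
    intro x hbx
    induction hbx with
    | refl => exact fun _ => hb
    | @tail y z hby hyz ih =>
      intro hza
      have hyz' : (G.split T).Edge y z := hyz
      by_contra hz
      refine hyz'.2 ⟨ih ((Edge.reach hyz').trans hza), hz, ?_⟩
      refine hG.edge_symm hyz'.1 (Reach.mono (G := G.split T) (fun _ _ h => h.1) ?_)
      exact hza.trans ((Edge.reach hab).trans hby)
  exact ha (key a hba (Reach.refl _))

/-- A new arrow `q → t` could create a triplex with a line `t - t'` inside `T` or a second new arrow
`q' → t`; these are shielded by `joined` and `complete`. It could destroy only `p → q - t`, which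
`parents` shields. -/
theorem Splittable.triplexEquiv {T : Set V} (h : G.Splittable T) : TriplexEquiv (G.split T) G := by
  refine ⟨fun a b => split_adj, fun a b c => ?_⟩
  have hac := split_adj (G := G) (T := T) (a := a) (b := c)
  have h1 := h.joined a
  have h2 := h.joined c
  have h3 := h.complete a
  have h4 := h.parents a b
  have h5 := h.parents c b
  simp only [Triplex, hac] at *
  simp only [Adj, Arrow, Line, MixedGraph.split] at *
  grind

theorem Splittable.mem {G₀ : MixedGraph V} {T : Set V} (h : G.Splittable T)
    (hG : G ∈ triplexClass G₀) : G.split T ∈ triplexClass G₀ :=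
  mem_triplexClass_of_equiv hG (hG.1.split T) h.triplexEquiv

/-- An arrow `v → w` between vertices without lines such that `v` and `w` have the same parents,
apart from `v`. -/
structure Covered (G : MixedGraph V) (v w : V) : Prop where
  arrow : G.Arrow v w
  no_line_left : ∀ z, ¬ G.Line v z
  no_line_right : ∀ z, ¬ G.Line w z
  parent_left : ∀ z, G.Edge z v → G.Edge z w
  parent_right : ∀ z, z ≠ v → G.Edge z w → G.Edge z v

/-- The arrow `v → w` is replaced by a line. -/
def merge (G : MixedGraph V) (v w : V) (h : v ≠ w) : MixedGraph V where
  Edge a b := G.Edge a b ∨ (a = w ∧ b = v)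
  irrefl a := by
    rintro (h' | ⟨rfl, rfl⟩)
    · exact G.irrefl a h'
    · exact h rfl

/-- The arrow `v → w` is reversed. -/
def flip (G : MixedGraph V) (v w : V) (h : v ≠ w) : MixedGraph V where
  Edge a b := (G.Edge a b ∧ ¬ (a = v ∧ b = w)) ∨ (a = w ∧ b = v)
  irrefl a := by
    rintro (h' | ⟨rfl, rfl⟩)
    · exact G.irrefl a h'.1
    · exact h rfl

section Flip

variable {v w : V}

theorem Covered.ne (h : G.Covered v w) : v ≠ w := Edge.ne h.arrow.1

theorem merge_split_right (h : G.Covered v w) : (G.merge v w h.ne).split {w} = G := by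
  ext a b
  have h1 := h.no_line_right
  have h2 := h.arrow
  have h3 := h.ne
  simp only [split, merge, Line, Arrow, Set.mem_singleton_iff] at *
  grind

theorem merge_split_left (h : G.Covered v w) :
    (G.merge v w h.ne).split {v} = G.flip v w h.ne := by
  ext a b
  have h1 := h.no_line_left
  have h2 := h.arrow
  have h3 := h.ne
  simp only [split, merge, flip, Line, Arrow, Set.mem_singleton_iff] at *
  grind

theorem merge_splittable_right (h : G.Covered v w) : (G.merge v w h.ne).Splittable {w} := by
  have h1 := h.no_line_right
  have h2 := h.arrow
  have h3 := h.ne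
  have h4 := h.parent_left
  simp only [Arrow, Line] at *
  constructor <;> simp only [merge, Line, Arrow, Set.mem_singleton_iff] <;> grind

theorem merge_splittable_left (h : G.Covered v w) : (G.merge v w h.ne).Splittable {v} := by
  have h1 := h.no_line_left
  have h2 := h.arrow
  have h3 := h.ne
  have h4 := h.parent_right
  have h5 := h.no_line_right
  simp only [Arrow, Line] at *
  constructor <;> simp only [merge, Line, Arrow, Set.mem_singleton_iff] <;> grind

/-- By `parent_right` every vertex except `w` that reaches `w` already reaches `v`, so only walks
from `w` gain from the new edge `w → v`. A closed one of these through another parent of `w` would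
give `v` a line. -/
theorem IsChainGraph.merge (hG : G.IsChainGraph) (h : G.Covered v w) :
    (G.merge v w h.ne).IsChainGraph := by
  rw [isChainGraph_iff]
  have key : ∀ x y, (G.merge v w h.ne).Reach x y → G.Reach x y ∨ (G.Reach x w ∧ G.Reach v y) := by
    intro x y hxy
    induction hxy with
    | refl => exact Or.inl (Reach.refl _)
    | @tail y z _ hyz ih =>
      rcases hyz with hyz | ⟨rfl, rfl⟩
      · exact ih.imp (fun h => h.trans (Edge.reach hyz))
          fun h => ⟨h.1, h.2.trans (Edge.reach hyz)⟩
      · exact Or.inr ⟨ih.elim id And.left, Reach.refl _⟩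
  have key' : ∀ x, G.Reach x w → x = w ∨ G.Reach x v := by
    intro x hx
    rcases Relation.ReflTransGen.cases_tail hx with h' | ⟨z, hxz, hzw⟩
    · exact Or.inl h'.symm
    · right
      by_cases hz : z = v
      · exact hz ▸ hxz
      · exact Reach.trans hxz (Edge.reach (h.parent_right z hz hzw))
  rintro a b (hab | ⟨rfl, rfl⟩) hba
  · rcases key b a hba with h' | ⟨h1, h2⟩
    · exact Or.inl (hG.edge_symm hab h')
    · rcases key' b h1 with rfl | h3
      · by_cases ha : a = v
        · exact Or.inr ⟨rfl, ha⟩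
        · have h4 := h.parent_right a ha hab
          exact absurd ⟨hG.edge_symm h4 h2, h4⟩ (h.no_line_left a)
      · exact Or.inl (hG.edge_symm hab (h3.trans h2))
  · exact Or.inl h.arrow.1

theorem Covered.flip_mem {G₀ : MixedGraph V} (h : G.Covered v w) (hG : G ∈ triplexClass G₀) :
    G.flip v w h.ne ∈ triplexClass G₀ := by
  have h1 := (merge_splittable_right h).triplexEquiv
  rw [merge_split_right h] at h1
  rw [← merge_split_left h]
  exact (merge_splittable_left h).mem (mem_triplexClass_of_equiv hG (hG.1.merge h) h1.symm)

theorem Covered.flip_mem_directed {G₀ : MixedGraph V} (h : G.Covered v w)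
    (hG : G ∈ directedMembers G₀) : G.flip v w h.ne ∈ directedMembers G₀ := by
  refine ⟨h.flip_mem hG.1, fun a b hab => hG.2 a b ?_⟩
  have h2 := h.arrow
  simp only [Line, flip, Arrow] at *
  grind

theorem Covered.flip_arrow (h : G.Covered v w) : (G.flip v w h.ne).Arrow w v := by
  have h2 := h.arrow
  have h3 := h.ne
  simp only [flip, Arrow] at *
  grind

theorem flip_arrow_iff (h : G.Covered v w) :
    (G.flip v w h.ne).Arrow a b ↔ (G.Arrow a b ∧ ¬ (a = v ∧ b = w)) ∨ (a = w ∧ b = v) := by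
  have h2 := h.arrow
  have h3 := h.ne
  simp only [flip, Arrow] at *
  grind

theorem reach_of_flip {hne : v ≠ w} {x y : V} (h : (G.flip v w hne).Reach x y)
    (hw : G.Reach w y) : G.Reach x y := by
  induction h using Relation.ReflTransGen.head_induction_on with
  | refl => exact Reach.refl _
  | head h _ ih =>
    rcases h with h | ⟨rfl, rfl⟩
    · exact (Edge.reach h.1).trans ih
    · exact hw

end Flip

/-! ### Reversible arrows of directed members -/

/-- The set of vertices from which `b` can be reached. -/
def ant (G : MixedGraph V) (b : V) : Set V := {a | G.Reach a b}

theorem IsChainGraph.ncard_ant_lt [Finite V] (hG : G.IsChainGraph) (h : G.Arrow a b) :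
    (G.ant a).ncard < (G.ant b).ncard := by
  refine Set.ncard_lt_ncard ?_ (Set.toFinite _)
  refine (Set.ssubset_iff_of_subset fun x hx => Reach.trans hx (Edge.reach h.1)).2
    ⟨b, Reach.refl _, hG.not_reach h⟩

/-- Among some arrows of a chain graph there is one whose head is minimal and, among those with
the same head, whose tail is maximal. -/
theorem IsChainGraph.exists_extremal [Finite V] (hG : G.IsChainGraph) {Δ : V → V → Prop}
    (hne : ∃ v w, Δ v w) : ∃ v w, Δ v w ∧ (∀ z u, Δ z u → ¬ G.Arrow u w) ∧
      ∀ z, Δ z w → ¬ G.Arrow v z := by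
  obtain ⟨v₀, w₀, h₀⟩ := hne
  obtain ⟨w, ⟨v₁, hw⟩, hmin⟩ := Set.exists_min_image {w | ∃ v, Δ v w}
    (fun w => (G.ant w).ncard) (Set.toFinite _) ⟨w₀, v₀, h₀⟩
  obtain ⟨v, hv, hmax⟩ := Set.exists_max_image {v | Δ v w}
    (fun v => (G.ant v).ncard) (Set.toFinite _) ⟨v₁, hw⟩
  exact ⟨v, w, hv, fun z u hzu h => absurd (hmin u ⟨z, hzu⟩) (not_le.2 (hG.ncard_ant_lt h)),
    fun z hz h => absurd (hmax z hz) (not_le.2 (hG.ncard_ant_lt h))⟩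

section Classes

variable {G₀ D E : MixedGraph V} {v w x y m : V}

theorem reversible_of_arrows (hD : D ∈ directedMembers G₀) (hE : E ∈ directedMembers G₀)
    (h : D.Arrow a b) (h' : E.Arrow b a) : Reversible G₀ a b :=
  ⟨⟨D, hD, h⟩, E, hE, h'⟩

/-- A vertex at which an arrow can be reversed has no lines. -/
theorem Reversible.not_line (h : Reversible G₀ x y) (hE : E ∈ directedMembers G₀) :
    ¬ E.Line x m := by
  intro hEm
  obtain ⟨⟨D₁, hD₁, h₁⟩, D₂, hD₂, h₂⟩ := h
  have e12 := triplexEquiv_of_mem hD₁.1 hD₂.1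
  have e21 := e12.symm
  have hm : D₂.Line x m := (line_iff_of_directed hE hD₂).1 hEm
  -- The reversal passes from `x` to each line neighbour `m`: the edge between `m` and `y` is also
  -- reversed between `D₁` and `D₂`. This is why `x` is quantified anew, for use at `m` in `f2`.
  have f1 : ∀ x, D₁.Arrow x y → D₂.Arrow y x → ∀ m, D₂.Line x m →
      D₂.Arrow y m ∧ D₁.Arrow m y := by
    intro x h₁ h₂ m hm
    have hym : y ≠ m := by
      rintro rfl
      exact h₂.2 hm.1
    have hadj := e21.adj_of_edges h₂.1 hm.2 (Or.inl h₂) hym (Or.inl h₁.2)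
    have hm' := (line_iff_of_directed hD₂ hD₁).1 hm
    exact ⟨hD₂.1.1.arrow_trans_left h₂ hm.1 hadj,
      hD₁.1.1.arrow_trans_right hm'.2 h₁ ((e12.1 _ _).2 hadj.symm)⟩
  have f2 : ∀ m r, D₂.Line x m → D₂.Line m r → x ≠ r → D₂.Adj x r := by
    intro m r hm hr hne
    obtain ⟨g1, g2⟩ := f1 x h₁ h₂ m hm
    obtain ⟨-, g3⟩ := f1 m g2 g1 r hr
    exact (e12.1 _ _).1 (e12.adj_of_edges h₁.1 g3.1 (Or.inl h₁) hne (Or.inl h₂.2))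
  have f3 : ∀ p r, D₂.Arrow p x → D₂.Line x r → D₂.Adj p r := by
    intro p r hp hr
    by_contra hn
    have hpr : p ≠ r := by
      rintro rfl
      exact hp.2 hr.1
    obtain ⟨g1, g2⟩ := f1 x h₁ h₂ r hr
    have hpy : p ≠ y := by
      rintro rfl
      exact hn g1.adj
    have hadj := e21.adj_of_edges hp.1 h₂.1 (Or.inl hp) hpy (Or.inr h₁.2)
    have hr' := (line_iff_of_directed hD₂ hD₁).1 hr
    have ht := (e21.2 p x r).1 ⟨hpr, hn, hp.1, hr.2, Or.inl hp⟩
    have hp' : D₁.Arrow p x := ht.2.2.2.2.resolve_right fun h => h.2 hr'.1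
    have hpy' := hD₁.1.1.arrow_trans_left hp' h₁.1 ((e12.1 _ _).2 hadj)
    exact hn ((e12.1 _ _).1 (e12.adj_of_edges hpy'.1 g2.1 (Or.inl hpy') hpr (Or.inr g1.2)))
  have hchain := hD₂.1.1
  -- By `f2` the vertex `x` is joined to all others of its chain component. Splitting these off from
  -- `x` is therefore allowed, and turns the line `x - m`, common to all members, into an arrow.
  have hq : ∀ q ∉ {m | D₂.Line x m}, ∀ t ∈ {m | D₂.Line x m}, D₂.Line q t → q = x := by
    intro q hq t ht hqt
    by_contra hne
    exact hq (hchain.line_trans ht hqt.symm (f2 t q ht hqt.symm (Ne.symm hne)))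
  have hs : D₂.Splittable {m | D₂.Line x m} := by
    constructor
    · intro q hqT t ht hqt t' ht'
      rw [hq q hqT t ht hqt]
      exact ht'
    · intro q hqT q' hqT' t ht hqt hqt' hne
      exact absurd ((hq q hqT t ht hqt).trans (hq q' hqT' t ht hqt').symm) hne
    · intro p q hqT t ht hpq hqt
      obtain rfl := hq q hqT t ht hqt
      exact hchain.arrow_trans_left hpq hqt.1 (f3 p t hpq hqt)
  have := hD₂.2 x m hm _ (hs.mem hD₂.1)
  exact this.2.2 ⟨hm, fun h => D₂.irrefl x h.1, hm.1⟩

theorem Reversible.arrow_of_edge (h : Reversible G₀ x y) (hE : E ∈ directedMembers G₀)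
    (he : E.Edge x m) : E.Arrow x m :=
  ⟨he, fun h' => h.not_line hE ⟨he, h'⟩⟩

theorem Reversible.arrow_of_edge' (h : Reversible G₀ x y) (hE : E ∈ directedMembers G₀)
    (he : E.Edge m x) : E.Arrow m x :=
  ⟨he, fun h' => h.not_line hE ⟨h', he⟩⟩

/-- The extremal arrow among the arrows of `D` that are reversed in `E` and point into a set
closed under parents is covered. -/
theorem exists_covered [Finite V] (hD : D ∈ directedMembers G₀) (hE : E ∈ directedMembers G₀)
    {S : Set V} (hS : ∀ a b, D.Arrow a b → b ∈ S → a ∈ S)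
    (hne : ∃ v w, D.Arrow v w ∧ E.Arrow w v ∧ w ∈ S) :
    ∃ v w, D.Arrow v w ∧ E.Arrow w v ∧ w ∈ S ∧ D.Covered v w := by
  have eDE := triplexEquiv_of_mem hD.1 hE.1
  obtain ⟨v, w, ⟨hvw, hwv, hwS⟩, hmin, hmax⟩ := hD.1.1.exists_extremal hne
  have hr := reversible_of_arrows hD hE hvw hwv
  refine ⟨v, w, hvw, hwv, hwS, hvw, fun z => hr.not_line hD, fun z => hr.symm.not_line hD, ?_, ?_⟩
  · intro z hzv
    have hzv := hr.arrow_of_edge' hD hzv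
    -- If `z → v` were reversed too, its head `v` would contradict the minimality of `w`.
    have hzv' : E.Arrow z v := (arrow_or_arrow hD hE hzv).resolve_right fun h =>
      hmin z v ⟨hzv, h, hS _ _ hvw hwS⟩ hvw
    have hzw : z ≠ w := by
      rintro rfl
      exact hzv.2 hvw.1
    have hadj := eDE.symm.adj_of_edges hzv'.1 hwv.1 (Or.inl hzv') hzw (Or.inr hvw.2)
    exact hD.1.1.edge_trans hzv.1 hvw.1 ((eDE.1 _ _).2 hadj)
  · intro z hne hzw
    have hzw := hr.symm.arrow_of_edge' hD hzw
    have hadj := eDE.adj_of_edges hzw.1 hvw.1 (Or.inl hzw) hne (Or.inr hwv.2)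
    -- With `v → z → w` in `D`, maximality of the tail gives `z → w` in `E`. Then `z → w → v` in
    -- `E`, so `v → z` is reversed and has a smaller head than `w`.
    refine hadj.resolve_right fun hvz => ?_
    have hvz := hr.arrow_of_edge hD hvz
    have hzw' : E.Arrow z w := (arrow_or_arrow hD hE hzw).resolve_right fun h =>
      hmax z ⟨hzw, h, hwS⟩ hvz
    have hzv' := hE.1.1.arrow_trans_left hzw' hwv.1 ((eDE.1 _ _).1 hadj)
    exact hmin v z ⟨hvz, hzv', hS _ _ hzw hwS⟩ hzw

/-- `D` has no in-arrows at `c` other than those of all directed members. -/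
def RootedAt (G₀ D : MixedGraph V) (c : V) : Prop :=
  ∀ p, D.Arrow p c → ∀ E ∈ directedMembers G₀, E.Arrow p c

theorem reach_of_agree {T : Set V} (hT : ∀ a b, D.Edge a b → b ∈ T → a ∈ T)
    (h : ∀ a b, E.Edge a b → ¬ D.Edge a b → a ∈ T ∧ b ∈ T) (hab : E.Reach a b) (hb : b ∈ T) :
    a ∈ T := by
  induction hab using Relation.ReflTransGen.head_induction_on with
  | refl => exact hb
  | @head x y hxy _ ih =>
    by_cases hD : D.Edge x y
    · exact hT _ _ hD ih
    · exact (h _ _ hxy hD).1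

theorem ant_closed : ∀ a b, D.Edge a b → b ∈ D.ant c → a ∈ D.ant c :=
  fun _ _ h h' => Reach.trans (Edge.reach h) h'

/-- Minimise the number of vertices that reach `c`. If an arrow into `c` were reversed in some `E`,
covered arrows above `c` could be reversed towards `E`; this adds no vertex above `c`, and a
reversal at `c` itself removes one. The changes never leave the original set above `c`. -/
theorem exists_rootedAt [Finite V] (hD : D ∈ directedMembers G₀) (c : V) :
    ∃ D' ∈ directedMembers G₀, RootedAt G₀ D' c ∧
      ∀ a b, D'.Edge a b → ¬ D.Edge a b → a ∈ D.ant c ∧ b ∈ D.ant c := by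
  let 𝒜 : Set (MixedGraph V) := {E | E ∈ directedMembers G₀ ∧
    ∀ a b, E.Edge a b → ¬ D.Edge a b → a ∈ D.ant c ∧ b ∈ D.ant c}
  obtain ⟨D', hD', hmin⟩ := Set.exists_min_image 𝒜 (fun E => (E.ant c).ncard) (Set.toFinite _)
    ⟨D, hD, fun _ _ h h' => absurd h h'⟩
  refine ⟨D', hD'.1, ?_, hD'.2⟩
  intro p hp E hE
  by_contra hn
  have hcp := (arrow_or_arrow hD'.1 hE hp).resolve_left hn
  -- Second minimisation: among the candidates that keep `p → c`, the fewest disagreements with `E`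
  -- above `c`.
  obtain ⟨F, ⟨hF, hFc, hFp⟩, hFmin⟩ := Set.exists_min_image
    {F | F ∈ 𝒜 ∧ (F.ant c).ncard ≤ (D'.ant c).ncard ∧ F.Arrow p c}
    (fun F => {e : V × V | F.Arrow e.1 e.2 ∧ E.Arrow e.2 e.1 ∧ e.2 ∈ F.ant c}.ncard)
    (Set.toFinite _) ⟨D', hD', le_rfl, hp⟩
  obtain ⟨v, w, hvw, hwv, hw, hcov⟩ := exists_covered hF.1 hE (S := F.ant c)
    (fun a b h => ant_closed a b h.1) ⟨p, c, hFp, hcp, Reach.refl _⟩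
  have hsub : (F.flip v w hcov.ne).ant c ⊆ F.ant c := fun x hx => reach_of_flip hx hw
  have hF' : F.flip v w hcov.ne ∈ 𝒜 := by
    refine ⟨hcov.flip_mem_directed hF.1, ?_⟩
    rintro a b (hab | ⟨rfl, rfl⟩) hn
    · exact hF.2 a b hab.1 hn
    · exact ⟨reach_of_agree ant_closed hF.2 hw (Reach.refl _),
        reach_of_agree ant_closed hF.2 (Reach.trans (Edge.reach hvw.1) hw) (Reach.refl _)⟩
  have hwc : w ≠ c := by
    rintro rfl
    refine absurd (hmin _ hF') (not_le.2 (lt_of_lt_of_le (Set.ncard_lt_ncard ?_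
      (Set.toFinite _)) hFc))
    refine (Set.ssubset_iff_of_subset hsub).2 ⟨v, Edge.reach hvw.1, ?_⟩
    exact hF'.1.1.1.not_reach hcov.flip_arrow
  refine absurd (hFmin _ ⟨hF', (Set.ncard_le_ncard hsub (Set.toFinite _)).trans hFc,
    (flip_arrow_iff hcov).2 (Or.inl ⟨hFp, fun h => hwc h.2.symm⟩)⟩)
    (not_le.2 (Set.ncard_lt_ncard ?_ (Set.toFinite _)))
  refine (Set.ssubset_iff_of_subset ?_).2 ⟨(v, w), ⟨hvw, hwv, hw⟩, ?_⟩
  · rintro ⟨x, y⟩ ⟨h1, h2, h3⟩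
    refine ⟨?_, h2, hsub h3⟩
    rcases (flip_arrow_iff hcov).1 h1 with h | ⟨h, h'⟩
    · exact h.1
    · simp only at h h' h2
      subst h h'
      exact absurd h2.1 hwv.2
  · rintro ⟨h1, -, -⟩
    exact h1.2 hcov.flip_arrow.1

end Classes

/-! ### No fixed arrow in a triangle with two reversible edges -/

section Triangles

variable {G₀ D E : MixedGraph V} {v w x y z m q : V}

theorem edge_propagates (hD : D ∈ directedMembers G₀) (hE : E ∈ directedMembers G₀)
    (hxy : E.Edge x y) (hyz : D.Edge y z) (hn : ¬ D.Adj x z) (hne : x ≠ z) : E.Edge y z := by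
  have e := triplexEquiv_of_mem hD.1 hE.1
  by_contra hn'
  have hzy : E.Edge z y := ((e.1 y z).1 hyz.adj).resolve_left hn'
  have := (e.2 x y z).2 ⟨hne, fun h => hn ((e.1 _ _).2 h), hxy, hzy, Or.inr ⟨hzy, hn'⟩⟩
  exact hn' ((line_iff_of_directed hD hE).1 ⟨hyz, this.2.2.2.1⟩).1

/-- Follow a geodesic of `D` from `w` to `b`, which has no chord, to its first vertex adjacent to
`c`. If this is not `w`, it is the middle of a triplex, which `E` shares; in `E` the triplex pushes
all later edges of the geodesic forward, so `c` reaches `b`, against `b → c`. -/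
theorem adj_of_between (hD : D ∈ directedMembers G₀) (hE : E ∈ directedMembers G₀)
    (hbc : Reversible G₀ b c) (hE' : E.Arrow b c) (hcw : D.Reach c w) (hwb : D.Reach w b)
    (hne : w ≠ c) : D.Adj c w := by
  by_contra hn
  have e := triplexEquiv_of_mem hD.1 hE.1
  obtain ⟨k, p, hp0, hpk, hp, hchord, hinj⟩ := exists_geodesic hwb
  have hnadj : ∀ i j, i + 1 < j → j ≤ k → ¬ D.Adj (p i) (p j) := by
    intro i j hij hj hadj
    have := hchord i j (by omega) hj
      (hD.1.1.edge_of_reach hadj (reach_of_steps hp (by omega) hj))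
    omega
  have hcp : ∀ i ≤ k, D.Reach c (p i) := fun i hi =>
    hcw.trans (hp0 ▸ reach_of_steps hp (Nat.zero_le _) hi)
  have hcne : ∀ i ≤ k, p i ≠ c := by
    intro i hi h
    have h1 : D.Reach w c := h ▸ hp0 ▸ reach_of_steps hp (Nat.zero_le _) hi
    obtain ⟨z, hz⟩ := hD.1.1.edge_symm_of_closed hcw h1 hne.symm
    exact hbc.symm.not_line hD hz
  classical
  have hex : ∃ j, j ≤ k ∧ D.Adj c (p j) :=
    ⟨k, le_rfl, hpk ▸ ((e.1 _ _).2 hE'.adj).symm⟩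
  obtain ⟨hjk, hadj⟩ := Nat.find_spec hex
  have hmin : ∀ i < Nat.find hex, i ≤ k → ¬ D.Adj c (p i) := fun i hi hik h =>
    Nat.find_min hex hi ⟨hik, h⟩
  generalize Nat.find hex = j at *
  obtain ⟨i, rfl⟩ : ∃ i, j = i + 1 := by
    refine Nat.exists_eq_succ_of_ne_zero ?_
    rintro rfl
    exact hn (hp0 ▸ hadj)
  have hcj := hbc.symm.arrow_of_edge hD (hD.1.1.edge_of_reach hadj (hcp _ hjk))
  have ht := (e.2 c (p (i + 1)) (p i)).1 ⟨(hcne i (by omega)).symm, hmin i (by omega) (by omega),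
    hcj.1, hp i (by omega), Or.inl hcj⟩
  have hprop : ∀ l, i ≤ l → l < k → E.Edge (p l) (p (l + 1)) := by
    intro l hl
    induction l, hl using Nat.le_induction with
    | base => exact fun _ => ht.2.2.2.1
    | succ l hl ih =>
      intro hlk
      refine edge_propagates hD hE (ih (by omega)) (hp _ hlk) (hnadj _ _ (by omega) (by omega)) ?_
      intro h
      have := hinj _ _ (by omega) (by omega) h
      omega
  have hreach : ∀ l, i + 1 ≤ l → l ≤ k → E.Reach (p (i + 1)) (p l) := by
    intro l hl
    induction l, hl using Nat.le_induction with
    | base => exact fun _ => Reach.refl _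
    | succ l hl ih =>
      exact fun hlk => (ih (by omega)).trans (Edge.reach (hprop l (by omega) (by omega)))
  exact hE.1.1.not_reach hE' ((Edge.reach ht.2.2.1).trans (hpk ▸ hreach k hjk le_rfl))

/-- `a → b` in all directed members, while the edges `a c` and `b c` are reversible; and the
directed member `D` is rooted at `c`. -/
structure BadTriangle (G₀ D : MixedGraph V) (a b c : V) : Prop where
  mem : D ∈ directedMembers G₀
  rooted : RootedAt G₀ D c
  arrow : ∀ E ∈ directedMembers G₀, E.Arrow a b
  left : Reversible G₀ a c
  right : Reversible G₀ b c

theorem RootedAt.arrow_of_reversible (hD : D ∈ directedMembers G₀) (h : RootedAt G₀ D c)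
    (hr : Reversible G₀ x c) : D.Arrow c x := by
  obtain ⟨⟨E, hE, hxc⟩, F, hF, hcx⟩ := hr
  exact (arrow_or_arrow hE hD hxc).resolve_left fun h' => hcx.2 (h x h' F hF).1

theorem RootedAt.flip (h : RootedAt G₀ D c) (hcov : D.Covered v w) (hvc : v ≠ c) :
    RootedAt G₀ (D.flip v w hcov.ne) c := by
  intro p hp
  rcases (flip_arrow_iff hcov).1 hp with h' | h'
  · exact h p h'.1
  · exact absurd h'.2.symm hvc

/-- The arrows of `D` reversed in `E` that lie strictly above `b` and do not leave `c`. -/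
def reversedAbove (D E : MixedGraph V) (b c : V) : Set (V × V) :=
  {e | D.Arrow e.1 e.2 ∧ E.Arrow e.2 e.1 ∧ e.2 ∈ D.ant b ∧ e.2 ≠ b ∧ e.1 ≠ c}

/-- An extremal arrow `v → w` among those reversed in `E` is covered, and can be reversed, unless `v
→ c → w`. In that case `v`, `c`, `w` form another bad triangle, which lies strictly above `b`. -/
theorem BadTriangle.descent_of_reversed [Finite V] (h : BadTriangle G₀ D a b c)
    (hE : E ∈ directedMembers G₀) (hbc : E.Arrow b c) (hne : (reversedAbove D E b c).Nonempty) :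
    (∃ D' a' b' c', BadTriangle G₀ D' a' b' c' ∧ (D'.ant b').ncard < (D.ant b).ncard) ∨
    ∃ D', BadTriangle G₀ D' a b c ∧ D'.ant b ⊆ D.ant b ∧
      reversedAbove D' E b c ⊂ reversedAbove D E b c := by
  have hD := h.mem
  have hch := hD.1.1
  have e := triplexEquiv_of_mem hD.1 hE.1
  obtain ⟨⟨v₀, w₀⟩, h₀⟩ := hne
  obtain ⟨v, w, ⟨hvw, hwv, hwb, hwb', hvc⟩, hmin, hmax⟩ :=
    hch.exists_extremal (Δ := fun v w => (v, w) ∈ reversedAbove D E b c) ⟨v₀, w₀, h₀⟩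
  simp only at hvw hwv hwb hwb' hvc
  have hr := reversible_of_arrows hD hE hvw hwv
  have hwc : w ≠ c := by
    rintro rfl
    exact hwv.2 (h.rooted v hvw E hE).1
  have hvb : v ∈ D.ant b := ant_closed _ _ hvw.1 hwb
  have above_ne : ∀ x y, D.Arrow x y → y ∈ D.ant b → x ≠ b := by
    rintro x y hxy hy rfl
    exact hch.not_reach hxy hy
  have hleft : ∀ z, D.Edge z v → D.Edge z w := by
    intro z hzv
    have hzv := hr.arrow_of_edge' hD hzv
    have hzw : z ≠ w := by
      rintro rfl
      exact hzv.2 hvw.1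
    by_contra hn
    have hn' : ¬ D.Adj z w := fun h' => hn (hch.edge_trans hzv.1 hvw.1 h')
    rcases arrow_or_arrow hD hE hzv with hzv' | hvz'
    · exact hn' ((e.1 _ _).2 (e.symm.adj_of_edges hzv'.1 hwv.1 (Or.inl hzv') hzw (Or.inr hvw.2)))
    -- Arrows out of `c` are not in `reversedAbove`, so minimality of the head says nothing about
    -- them.
    · by_cases hzc : z = c
      · subst hzc
        exact hn' (adj_of_between hD hE h.right hbc
          ((Edge.reach hzv.1).trans (Edge.reach hvw.1)) hwb hwc)
      · exact hmin z v ⟨hzv, hvz', hvb, above_ne _ _ hvw hwb, hzc⟩ hvw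
  by_cases hright : ∀ z, z ≠ v → D.Edge z w → D.Edge z v
  · right
    have hcov : D.Covered v w :=
      ⟨hvw, fun z => hr.not_line hD, fun z => hr.symm.not_line hD, hleft, hright⟩
    have hsub : (D.flip v w hcov.ne).ant b ⊆ D.ant b := fun x hx => reach_of_flip hx hwb
    refine ⟨D.flip v w hcov.ne, ⟨hcov.flip_mem_directed hD, h.rooted.flip hcov hvc, h.arrow,
      h.left, h.right⟩, hsub, ?_⟩
    refine (Set.ssubset_iff_of_subset ?_).2 ⟨(v, w), ⟨hvw, hwv, hwb, hwb', hvc⟩,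
      fun h' => h'.1.2 hcov.flip_arrow.1⟩
    rintro ⟨x, y⟩ ⟨h1, h2, h3, h4⟩
    refine ⟨?_, h2, hsub h3, h4⟩
    rcases (flip_arrow_iff hcov).1 h1 with h5 | ⟨h5, h6⟩
    · exact h5.1
    · simp only at h5 h6 h2
      subst h5 h6
      exact absurd h2.1 hwv.2
  · left
    push Not at hright
    obtain ⟨z, hzv, hzw, hnzv⟩ := hright
    have hzw := hr.symm.arrow_of_edge' hD hzw
    have hadj := e.adj_of_edges hzw.1 hvw.1 (Or.inl hzw) hzv (Or.inr hwv.2)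
    have hvz := hr.arrow_of_edge hD (hadj.resolve_left hnzv)
    have hzc : z = c := by
      by_contra hzc
      have hzw' : E.Arrow z w := (arrow_or_arrow hD hE hzw).resolve_right fun h' =>
        hmax z ⟨hzw, h', hwb, hwb', hzc⟩ hvz
      have hzv' := hE.1.1.arrow_trans_left hzw' hwv.1 ((e.1 _ _).1 hadj)
      exact hmin v z ⟨hvz, hzv', ant_closed _ _ hzw.1 hwb, above_ne _ _ hzw hwb, hvc⟩ hzw
    -- Rootedness at `c` fixes `v → c` in all directed members, while `E` has `w → v → c`, so the
    -- edge between `c` and `w` is reversible.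
    subst hzc
    have hF := h.rooted v hvz
    have hwc' := hE.1.1.arrow_trans_left hwv (hF E hE).1 ((e.1 _ _).1 hzw.adj.symm)
    obtain ⟨D', hD', hroot, hagree⟩ := exists_rootedAt hD w
    refine ⟨D', v, z, w, ⟨hD', hroot, hF, hr, reversible_of_arrows hD hE hzw hwc'⟩, ?_⟩
    refine Set.ncard_lt_ncard ?_ (Set.toFinite _)
    have hsub : D'.ant z ⊆ D.ant w := fun x hx =>
      reach_of_agree ant_closed hagree hx (Edge.reach hzw.1)
    refine (Set.ssubset_iff_of_subset fun x hx => Reach.trans (hsub hx) hwb).2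
      ⟨b, Reach.refl _, fun hb => ?_⟩
    obtain ⟨l, hl⟩ := hch.edge_symm_of_closed (hsub hb) hwb hwb'.symm
    exact h.right.not_line hD hl

/-- With no such disagreement left above `b`, an arrow `q → b` with maximal tail is covered: any
obstruction would produce a new adjacency from the shared triplexes, or an arrow still reversed.
Reversing it removes `q` from the vertices that reach `b`. -/
theorem BadTriangle.descent_of_agree [Finite V] (h : BadTriangle G₀ D a b c)
    (hE : E ∈ directedMembers G₀) (hbc : E.Arrow b c) (hempty : reversedAbove D E b c = ∅) :
    ∃ D', BadTriangle G₀ D' a b c ∧ (D'.ant b).ncard < (D.ant b).ncard := by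
  have hD := h.mem
  have hch := hD.1.1
  have hchE := hE.1.1
  have e := triplexEquiv_of_mem hD.1 hE.1
  have hca := h.rooted.arrow_of_reversible hD h.left
  have hcb := h.rooted.arrow_of_reversible hD h.right
  have hab := h.arrow D hD
  obtain ⟨q, hqb, hmax⟩ := Set.exists_max_image {q | D.Arrow q b} (fun q => (D.ant q).ncard)
    (Set.toFinite _) ⟨a, hab⟩
  have hmax' : ∀ z, D.Arrow z b → ¬ D.Arrow q z := fun z hz hqz =>
    absurd (hmax z hz) (not_le.2 (hch.ncard_ant_lt hqz))
  have hqb : D.Arrow q b := hqb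
  -- The path `c → a → b` shows that `c` is not a maximal parent of `b`.
  have hqc : q ≠ c := by
    rintro rfl
    exact hmax' a hab hca
  have hadj_c : ∀ z, D.Arrow z b → z ≠ c → D.Adj z c := fun z hz hne =>
    e.adj_of_edges hz.1 hcb.1 (Or.inl hz) hne (Or.inr hbc.2)
  have hcq : D.Arrow c q := by
    rcases hadj_c q hqb hqc with h' | h'
    · exact absurd (h.right.symm.arrow_of_edge' hD h') (hmax' c hcb)
    · exact h.right.symm.arrow_of_edge hD h'
  have hqR : ∃ x, Reversible G₀ q x := by
    rcases arrow_or_arrow hD hE hqb with hqb' | hbq'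
    · refine ⟨c, reversible_of_arrows hE hD ?_ hcq⟩
      exact hchE.arrow_trans_left hqb' hbc.1 ((e.1 _ _).1 hcq.adj.symm)
    · exact ⟨b, reversible_of_arrows hD hE hqb hbq'⟩
  obtain ⟨x, hqx⟩ := hqR
  have hright : ∀ z, z ≠ q → D.Edge z b → D.Edge z q := by
    intro z hne hzb
    have hzb := h.right.arrow_of_edge' hD hzb
    have hadj : D.Adj z q := by
      by_contra hn
      have ht := (e.2 z b q).1 ⟨hne, hn, hzb.1, hqb.1, Or.inl hzb⟩
      have hzc : z ≠ c := by
        rintro rfl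
        exact hn hcq.adj
      have hzb' := h.right.arrow_of_edge' hE ht.2.2.1
      have hzc' := hchE.arrow_trans_left hzb' hbc.1 ((e.1 _ _).1 (hadj_c z hzb hzc))
      have hqc' := hchE.edge_trans ht.2.2.2.1 hbc.1 ((e.1 _ _).1 hcq.adj.symm)
      exact hn ((e.1 _ _).2 (e.symm.adj_of_edges hzc'.1 hqc' (Or.inl hzc') hne (Or.inr hcq.2)))
    refine hadj.resolve_right fun hqz => hmax' z hzb (hqx.arrow_of_edge hD hqz)
  have hleft : ∀ y, D.Edge y q → D.Edge y b := by
    intro y hyq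
    have hyq := hqx.arrow_of_edge' hD hyq
    by_contra hn
    have hn' : ¬ D.Adj y b := fun h' => hn (hch.edge_trans hyq.1 hqb.1 h')
    have hyb : y ≠ b := by
      rintro rfl
      exact hyq.2 hqb.1
    have hyc : y ≠ c := by
      rintro rfl
      exact hn hcb.1
    have key : E.Edge c q → ¬ E.Edge y q := by
      intro hcq' hyq'
      have hbq' := hchE.arrow_trans_left hbc hcq' ((e.1 _ _).1 hqb.adj.symm)
      exact hn' ((e.1 _ _).2 (e.symm.adj_of_edges hyq' hbq'.1 (Or.inr hbq') hyb (Or.inr hqb.2)))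
    have hadj : D.Adj y c := by
      by_contra hn2
      have ht := (e.2 y q c).1 ⟨hyc, hn2, hyq.1, hcq.1, Or.inl hyq⟩
      exact key ht.2.2.2.1 ht.2.2.1
    have hcy' : E.Arrow c y := by
      refine h.right.symm.arrow_of_edge hE (((e.1 _ _).1 hadj).resolve_left fun hyc' => ?_)
      exact hn' ((e.1 _ _).2 (e.symm.adj_of_edges hyc' hbc.1 (Or.inr hbc) hyb (Or.inr hcb.2)))
    rcases arrow_or_arrow hD hE hyq with hyq' | hqy'
    · refine key ?_ hyq'.1
      exact hchE.edge_trans hcy'.1 hyq'.1 ((e.1 _ _).1 hcq.adj)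
    · have : (y, q) ∈ reversedAbove D E b c :=
        ⟨hyq, hqy', Edge.reach hqb.1, hqb.adj.ne, hyc⟩
      rw [hempty] at this
      exact this
  have hcov : D.Covered q b :=
    ⟨hqb, fun z => hqx.not_line hD, fun z => h.right.not_line hD, hleft, hright⟩
  refine ⟨D.flip q b hcov.ne, ⟨hcov.flip_mem_directed hD, h.rooted.flip hcov hqc, h.arrow,
    h.left, h.right⟩, Set.ncard_lt_ncard ?_ (Set.toFinite _)⟩
  exact (Set.ssubset_iff_of_subset fun x hx => reach_of_flip hx (Reach.refl _)).2
    ⟨q, Edge.reach hqb.1, (hcov.flip_mem_directed hD).1.1.not_reach hcov.flip_arrow⟩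

/-- Lexicographic descent: first on the number of vertices that reach `b`, then, for a fixed `E`
with `b → c`, on the number of reversed arrows above `b`. -/
theorem not_badTriangle [Finite V] (n : ℕ) : ∀ (D : MixedGraph V) (a b c : V),
    BadTriangle G₀ D a b c → (D.ant b).ncard ≠ n := by
  induction n using Nat.strong_induction_on with
  | _ n ih =>
    intro D a b c h hn
    obtain ⟨E, hE, hbc⟩ := h.right.1
    have inner : ∀ m, ∀ D, BadTriangle G₀ D a b c → (D.ant b).ncard ≤ n →
        (reversedAbove D E b c).ncard ≠ m := by
      intro m
      induction m using Nat.strong_induction_on with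
      | _ m ihm =>
        intro D h hn hm
        rcases (reversedAbove D E b c).eq_empty_or_nonempty with h0 | h0
        · obtain ⟨D', h', hlt⟩ := h.descent_of_agree hE hbc h0
          exact ih _ (lt_of_lt_of_le hlt hn) D' a b c h' rfl
        · rcases h.descent_of_reversed hE hbc h0 with ⟨D', a', b', c', h', hlt⟩ |
            ⟨D', h', hsub, hlt⟩
          · exact ih _ (lt_of_lt_of_le hlt hn) D' a' b' c' h' rfl
          · exact ihm _ (hm ▸ Set.ncard_lt_ncard hlt (Set.toFinite _)) D' h'
              ((Set.ncard_le_ncard hsub (Set.toFinite _)).trans hn) rfl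
    exact inner _ D h hn.le rfl

/-- No arrow of all directed members lies in a triangle with two reversible edges. -/
theorem not_reversible_triangle [Finite V] (hab : ∀ E ∈ directedMembers G₀, E.Arrow a b)
    (hac : Reversible G₀ a c) (hbc : Reversible G₀ b c) : False := by
  obtain ⟨D, hD, -⟩ := hac.1
  obtain ⟨D', hD', hroot, -⟩ := exists_rootedAt hD c
  exact not_badTriangle _ D' a b c ⟨hD', hroot, hab, hac, hbc⟩ rfl

end Triangles

/-! ### The essential graph of a triplex class -/

section Essential

variable {G₀ : MixedGraph V}

theorem essentialGraph_edge_iff (hG : G ∈ triplexClass G₀) :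
    (essentialGraph (triplexClass G₀)).Edge a b ↔ G.Adj a b ∧
      ((∃ H ∈ triplexClass G₀, H.Arrow b a) → ∃ H ∈ triplexClass G₀, H.Arrow a b) := by
  have hadj : ∀ H ∈ triplexClass G₀, (H.Adj a b ↔ G.Adj a b) := fun H hH =>
    (triplexEquiv_of_mem hH hG).1 a b
  constructor
  · rintro ⟨-, ⟨⟨H, hH, h⟩, -⟩ | h | ⟨⟨H, hH, h⟩, -⟩⟩
    · exact ⟨(hadj H hH).1 h.adj, fun _ => ⟨H, hH, h⟩⟩
    · exact ⟨(h G hG).adj, fun ⟨H, hH, h'⟩ => absurd (h H hH).1 h'.2⟩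
    · exact ⟨(hadj H hH).1 h.adj, fun _ => ⟨H, hH, h⟩⟩
  · rintro ⟨h, h'⟩
    refine ⟨h.ne, ?_⟩
    by_cases hba : ∃ H ∈ triplexClass G₀, H.Arrow b a
    · exact Or.inr (Or.inr ⟨h' hba, hba⟩)
    · push Not at hba
      by_cases hab : ∃ H ∈ triplexClass G₀, H.Arrow a b
      · exact Or.inl ⟨hab, hba⟩
      · push Not at hab
        refine Or.inr (Or.inl fun H hH => ?_)
        rcases adj_iff_arrow_or_line.1 ((hadj H hH).2 h) with h1 | h1 | h1
        · exact absurd h1 (hab H hH)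
        · exact h1
        · exact absurd h1 (hba H hH)

theorem essentialGraph_sameSkeleton (hG : G ∈ triplexClass G₀) :
    SameSkeleton (essentialGraph (triplexClass G₀)) G := by
  intro a b
  have h1 := essentialGraph_edge_iff (a := a) (b := b) hG
  have h2 := essentialGraph_edge_iff (a := b) (b := a) hG
  have h3 : G.Adj a b ↔ G.Adj b a := ⟨Adj.symm, Adj.symm⟩
  rw [Adj, h1, h2, ← h3]
  generalize (∃ H ∈ triplexClass G₀, H.Arrow a b) = p
  generalize (∃ H ∈ triplexClass G₀, H.Arrow b a) = q
  by_cases hp : p <;> simp +contextual [hp]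

theorem essentialGraph_triplexEquiv (hG : G ∈ triplexClass G₀) :
    TriplexEquiv (essentialGraph (triplexClass G₀)) G := by
  refine ⟨essentialGraph_sameSkeleton hG, ?_⟩
  have hE := fun a b => essentialGraph_edge_iff (a := a) (b := b) hG
  have hA := fun a b => essentialGraph_arrow (triplexClass G₀) a b
  have hS := essentialGraph_sameSkeleton hG
  -- If the members had no triplex here, a member with `a → b` would have `b → c`. The essential
  -- edge then supplies a member with `c → b`, which must have `b → a`, against essentiality of `a →
  -- b`.
  have key : ∀ a b c, ¬ G.Adj a c → a ≠ c → EssentialArrow (triplexClass G₀) a b →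
      (essentialGraph (triplexClass G₀)).Edge c b → G.Triplex a b c := by
    rintro a b c hn hne ⟨⟨G₁, hG₁, h₁⟩, hno⟩ hcb
    by_contra ht
    have ht' : ∀ H ∈ triplexClass G₀, ¬ H.Triplex a b c := fun H hH h =>
      ht (((triplexEquiv_of_mem hH hG).2 a b c).1 h)
    have hn' : ∀ H ∈ triplexClass G₀, ¬ H.Adj a c := fun H hH h =>
      hn (((triplexEquiv_of_mem hH hG).1 a c).1 h)
    obtain ⟨hadj, himp⟩ := (hE c b).1 hcb
    have hcb₁ : ¬ G₁.Edge c b := fun h => ht' G₁ hG₁ ⟨hne, hn' _ hG₁, h₁.1, h, Or.inl h₁⟩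
    have hbc₁ := (((triplexEquiv_of_mem hG₁ hG).1 c b).2 hadj).resolve_left hcb₁
    obtain ⟨G₂, hG₂, h₂⟩ := himp ⟨G₁, hG₁, hbc₁, hcb₁⟩
    have hab₂ : ¬ G₂.Edge a b := fun h => ht' G₂ hG₂ ⟨hne, hn' _ hG₂, h, h₂.1, Or.inr h₂⟩
    exact hno G₂ hG₂
      ⟨(((triplexEquiv_of_mem hG₁ hG₂).1 a b).1 h₁.adj).resolve_left hab₂, hab₂⟩
  intro a b c
  constructor
  · rintro ⟨hne, hn, hab, hcb, h | h⟩
    · exact key a b c (fun h' => hn ((hS a c).2 h')) hne ((hA a b).1 h) hcb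
    · exact (key c b a (fun h' => hn ((hS a c).2 h'.symm)) hne.symm ((hA c b).1 h) hab).symm
  · intro ht
    have ht' : ∀ H ∈ triplexClass G₀, H.Triplex a b c := fun H hH =>
      ((triplexEquiv_of_mem hH hG).2 a b c).2 ht
    have hba : ∀ H ∈ triplexClass G₀, ¬ H.Arrow b a := fun H hH h => h.2 (ht' H hH).2.2.1
    have hbc : ∀ H ∈ triplexClass G₀, ¬ H.Arrow b c := fun H hH h => h.2 (ht' H hH).2.2.2.1
    refine ⟨ht.1, fun h' => ht.2.1 ((hS a c).1 h'), (hE a b).2 ⟨Edge.adj ht.2.2.1, ?_⟩,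
      (hE c b).2 ⟨Edge.adj ht.2.2.2.1, ?_⟩, ?_⟩
    · rintro ⟨H, hH, h⟩
      exact absurd h (hba H hH)
    · rintro ⟨H, hH, h⟩
      exact absurd h (hbc H hH)
    · exact ht.2.2.2.2.imp (fun h => (hA a b).2 ⟨⟨G, hG, h⟩, hba⟩)
        fun h => (hA c b).2 ⟨⟨G, hG, h⟩, hbc⟩

theorem reversible_of_mem [Finite V] (hG : G ∈ triplexClass G₀) (hH : H ∈ triplexClass G₀)
    (h : G.Arrow a b) (h' : H.Arrow b a) : Reversible G₀ a b := by
  obtain ⟨D, hD⟩ := directedMembers_nonempty hG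
  exact ⟨⟨_, refine_mem_directed hG hD, refine_arrow_of_arrow h⟩,
    _, refine_mem_directed hH hD, refine_arrow_of_arrow h'⟩

/-- Adicyclicity of the members forces both orientations of the other two edges to occur, and
refinement carries these to directed members; so the cycle is an instance of the excluded triangle.
-/
theorem essentialGraph_not_triangle [Finite V] (hG : G ∈ triplexClass G₀)
    (hab : EssentialArrow (triplexClass G₀) a b)
    (hbc : (essentialGraph (triplexClass G₀)).Edge b c)
    (hca : (essentialGraph (triplexClass G₀)).Edge c a) : False := by
  obtain ⟨⟨G₁, hG₁, h₁⟩, hno⟩ := hab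
  have hadj : ∀ x y, ∀ H ∈ triplexClass G₀, G.Adj x y → H.Adj x y := fun x y H hH =>
    ((triplexEquiv_of_mem hG hH).1 x y).1
  obtain ⟨hbc, hbc'⟩ := (essentialGraph_edge_iff hG).1 hbc
  obtain ⟨hca, hca'⟩ := (essentialGraph_edge_iff hG).1 hca
  have hab' : ∀ H ∈ triplexClass G₀, H.Edge a b := by
    intro H hH
    by_contra hn
    exact hno H hH
      ⟨(((triplexEquiv_of_mem hG₁ hH).1 a b).1 h₁.adj).resolve_left hn, hn⟩
  have hac : ∃ H ∈ triplexClass G₀, H.Arrow a c := by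
    by_contra hn
    push Not at hn
    have hca₂ : ∀ H ∈ triplexClass G₀, H.Edge c a := by
      intro H hH
      by_contra h
      exact hn H hH ⟨(hadj c a H hH hca).resolve_left h, h⟩
    have hbc₁ : ¬ G₁.Edge b c := fun h =>
      hG₁.1.not_reach h₁ ((Edge.reach h).trans (Edge.reach (hca₂ G₁ hG₁)))
    obtain ⟨G₂, hG₂, h₂⟩ := hbc' ⟨G₁, hG₁, (hadj b c G₁ hG₁ hbc).resolve_left hbc₁, hbc₁⟩
    exact hG₂.1.not_reach h₂ ((Edge.reach (hca₂ G₂ hG₂)).trans (Edge.reach (hab' G₂ hG₂)))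
  obtain ⟨G₂, hG₂, h₂⟩ := hca' hac
  obtain ⟨G₃, hG₃, h₃⟩ := hac
  have hcb : G₂.Arrow c b := hG₂.1.arrow_trans_left h₂ (hab' G₂ hG₂) (hadj b c G₂ hG₂ hbc).symm
  obtain ⟨G₄, hG₄, h₄⟩ := hbc' ⟨G₂, hG₂, hcb⟩
  refine not_reversible_triangle (G₀ := G₀) (a := a) (b := b) (c := c) (fun E hE => ?_)
    (reversible_of_mem hG₃ hG₂ h₃ h₂) (reversible_of_mem hG₄ hG₂ h₄ hcb)
  refine ⟨hab' E hE.1, fun h => ?_⟩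
  exact h₁.2 (hE.2 a b ⟨hab' E hE.1, h⟩ G₁ hG₁).2

theorem essentialGraph_isChainGraph [Finite V] (hG : G ∈ triplexClass G₀) :
    (essentialGraph (triplexClass G₀)).IsChainGraph := by
  set U := essentialGraph (triplexClass G₀) with hU
  have hE := fun a b => essentialGraph_edge_iff (a := a) (b := b) hG
  have hS := essentialGraph_sameSkeleton hG
  by_contra hnot
  -- The cycle has length `k + 1`: a geodesic with `k` edges, closed by an arrow from its end to its
  -- start.
  have hex : ∃ k, ∃ v : ℕ → V, U.Arrow (v k) (v 0) ∧ (∀ i < k, U.Edge (v i) (v (i + 1))) ∧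
      (∀ i j, i < j → j ≤ k → U.Edge (v i) (v j) → j = i + 1) ∧
      ∀ i j, i ≤ k → j ≤ k → v i = v j → i = j := by
    rw [isChainGraph_iff] at hnot
    push Not at hnot
    obtain ⟨a, b, hab, hba, hn⟩ := hnot
    obtain ⟨k, v, h0, hk, hv⟩ := exists_geodesic hba
    exact ⟨k, v, by rw [h0, hk]; exact ⟨hab, hn⟩, hv⟩
  classical
  obtain ⟨v, harr, hv, hchord, hinj⟩ := Nat.find_spec hex
  have hmin : ∀ {x y : V} {m : ℕ}, U.Arrow x y → m < Nat.find hex →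
      ¬ ∃ w : ℕ → V, w 0 = y ∧ w m = x ∧ (∀ i < m, U.Edge (w i) (w (i + 1))) ∧
      (∀ i j, i < j → j ≤ m → U.Edge (w i) (w j) → j = i + 1) ∧
      ∀ i j, i ≤ m → j ≤ m → w i = w j → i = j := by
    rintro x y m hxy hm ⟨w, h0, hm', hw⟩
    exact Nat.find_min hex hm ⟨w, by rw [h0, hm']; exact hxy, hw⟩
  generalize Nat.find hex = k at *
  -- A forward chord would shorten the geodesic; a chord that is only backward is an arrow and
  -- closes a shorter cycle.
  have hnadj : ∀ i j, i + 1 < j → j ≤ k → ¬ (i = 0 ∧ j = k) → ¬ U.Adj (v i) (v j) := by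
    intro i j hij hj hne hadj
    have hnot : ¬ U.Edge (v i) (v j) := fun h => by
      have := hchord i j (by omega) hj h
      omega
    refine hmin (m := j - i) ⟨hadj.resolve_left hnot, hnot⟩ (by omega)
      ⟨fun l => v (i + l), by simp, by simp [show i + (j - i) = j by omega], ?_, ?_, ?_⟩
    · exact fun l hl => hv (i + l) (by omega)
    · intro l l' hl hl' h
      have := hchord (i + l) (i + l') (by omega) (by omega) h
      omega
    · intro l l' hl hl' h
      have := hinj (i + l) (i + l') (by omega) (by omega) h
      omega
  have hess := (essentialGraph_arrow _ _ _).1 harr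
  rcases k with _ | _ | _ | k
  · exact harr.2 harr.1
  · exact harr.2 (hv 0 (by omega))
  · exact essentialGraph_not_triangle hG hess (hv 0 (by omega)) (hv 1 (by omega))
  obtain ⟨⟨G₁, hG₁, h₁⟩, -⟩ := hess
  -- Otherwise `z → y` makes a triplex in `G₁`, whereas the edge of `U` yields a member with `y →
  -- z`.
  have prop : ∀ x y z, x ≠ z → ¬ U.Adj x z → G₁.Edge x y → U.Edge y z → G₁.Edge y z := by
    intro x y z hne hn hxy hyz
    by_contra hyz'
    have e₁ := triplexEquiv_of_mem hG₁ hG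
    obtain ⟨hadj, himp⟩ := (hE y z).1 hyz
    have hzy : G₁.Edge z y := ((e₁.1 y z).2 hadj).resolve_left hyz'
    obtain ⟨G₂, hG₂, h₂⟩ := himp ⟨G₁, hG₁, hzy, hyz'⟩
    have := ((triplexEquiv_of_mem hG₁ hG₂).2 x y z).1 ⟨hne,
      fun h => hn ((hS x z).2 ((e₁.1 x z).1 h)), hxy, hzy, Or.inr ⟨hzy, hyz'⟩⟩
    exact h₂.2 this.2.2.2.1
  have hfwd : ∀ i, i < k + 3 → G₁.Edge (v i) (v (i + 1)) := by
    intro i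
    induction i with
    | zero =>
      intro _
      refine prop (v (k + 3)) (v 0) (v 1) (fun h => ?_) (fun h => ?_) h₁.1 (hv 0 (by omega))
      · have := hinj _ _ le_rfl (by omega) h
        omega
      · exact hnadj 1 (k + 3) (by omega) le_rfl (by omega) h.symm
    | succ i ih =>
      intro hi
      refine prop (v i) (v (i + 1)) (v (i + 2)) (fun h => ?_) ?_ (ih (by omega)) (hv _ hi)
      · have := hinj _ _ (by omega) (by omega) h
        omega
      · exact hnadj _ _ (by omega) (by omega) (by omega)
  exact hG₁.1.not_reach h₁ (reach_of_steps hfwd (Nat.zero_le _) le_rfl)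

theorem essentialGraph_mem [Finite V] (hG : G ∈ triplexClass G₀) :
    essentialGraph (triplexClass G₀) ∈ triplexClass G₀ :=
  mem_triplexClass_of_equiv hG (essentialGraph_isChainGraph hG) (essentialGraph_triplexEquiv hG)

end Essential

/-! ### Open routes are preserved by splits -/

/-- How the last edge of a route meets the last vertex. -/
inductive Mark
  | head
  | line
  | tail

/-- `G.Open A C y τ`: a route from a vertex of `A` arrives at `y` by an edge with mark `τ` at `y`,
such that the inner vertices at which the route has one of the forms `→ y ←`, `→ y -`, `- y ←`
are in `C`, and all others are not in `C`. -/
inductive Open (G : MixedGraph V) (A C : Set V) : V → Mark → Prop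
  | start {a : V} : a ∈ A → Open G A C a .tail
  | out {y z : V} {τ : Mark} : Open G A C y τ → G.Arrow y z → y ∉ C → Open G A C z .head
  | line {y z : V} {τ : Mark} : Open G A C y τ → G.Line y z → (y ∈ C ↔ τ = .head) →
      Open G A C z .line
  | into {y z : V} {τ : Mark} : Open G A C y τ → G.Arrow z y → (y ∈ C ↔ τ ≠ .tail) →
      Open G A C z .tail

theorem split_arrow_iff {T : Set V} :
    (G.split T).Arrow a b ↔ G.Arrow a b ∨ (a ∉ T ∧ b ∈ T ∧ G.Line a b) := by
  simp only [split, Arrow, Line]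
  tauto

theorem split_line_iff {T : Set V} :
    (G.split T).Line a b ↔ G.Line a b ∧ (a ∈ T ↔ b ∈ T) := by
  simp only [split, Line]
  tauto

section Simulation

variable {A C T : Set V}

/-- The route has arrived at `y` by a line or against an arrow. -/
def OpenNonhead (G : MixedGraph V) (A C : Set V) (y : V) : Prop :=
  G.Open A C y .line ∨ G.Open A C y .tail

/-- The vertices outside `T` that have a line into `T`. -/
def Boundary (G : MixedGraph V) (T : Set V) (q : V) : Prop := q ∉ T ∧ ∃ t ∈ T, G.Line q t

theorem OpenNonhead.out {y z : V} (h : G.OpenNonhead A C y) (hyz : G.Arrow y z) (hy : y ∉ C) :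
    G.Open A C z .head :=
  h.elim (fun h => .out h hyz hy) fun h => .out h hyz hy

theorem OpenNonhead.line {y z : V} (h : G.OpenNonhead A C y) (hyz : G.Line y z) (hy : y ∉ C) :
    G.Open A C z .line :=
  h.elim (fun h => .line h hyz (by simp [hy])) fun h => .line h hyz (by simp [hy])

/-- What a route of `G.split T` tells about routes of `G`. -/
def UnsplitInv (G : MixedGraph V) (A C T : Set V) (y : V) : Mark → Prop
  | .head => (y ∈ T → G.Open A C y .head ∨ ∃ q, G.Boundary T q ∧ q ∉ C ∧ G.OpenNonhead A C q) ∧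
      (y ∉ T → G.Open A C y .head) ∧ (G.Boundary T y → ∀ t ∈ T, G.Open A C t .head)
  | .line => G.Open A C y .line ∧ (y ∈ T → ∀ q, G.Boundary T q → G.OpenNonhead A C q)
  | .tail => (G.Boundary T y → y ∈ C ∨
      (G.OpenNonhead A C y ∧ ∀ z, G.Arrow z y → G.Open A C z .tail)) ∧
      (¬ G.Boundary T y → G.Open A C y .tail)

theorem Splittable.line_of_boundary (h : G.Splittable T) {q t : V} (hq : G.Boundary T q)
    (ht : t ∈ T) : G.Line q t := by
  obtain ⟨hqT, t', ht', hl⟩ := hq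
  exact h.joined q hqT t' ht' hl t ht

theorem Splittable.line_boundary (h : G.Splittable T) {q q' : V} (hq : G.Boundary T q)
    (hq' : G.Boundary T q') (hne : q ≠ q') : G.Line q q' := by
  obtain ⟨hqT, t, ht, hl⟩ := hq
  exact h.complete q hqT q' hq'.1 t ht hl (h.line_of_boundary hq' ht) hne

theorem Splittable.parent_boundary (h : G.Splittable T) {p q t : V} (hq : G.Boundary T q)
    (hp : G.Arrow p q) (ht : t ∈ T) : G.Arrow p t :=
  h.parents p q hq.1 t ht hp (h.line_of_boundary hq ht)

/-- An arrow `q → t` of the split that is a line of `G` can change the status of `q` and `t` on a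
route, and the invariant stores the detours. At `t`, one may return to `q ∉ C`, which has lines to
all of `T` and to the rest of the boundary. At `q`, one may avoid `q`, since its parents are parents
of every vertex of `T`. -/
theorem UnsplitInv.out (h : G.Splittable T) {y z : V} {τ : Mark}
    (ih : UnsplitInv G A C T y τ) (hyz : (G.split T).Arrow y z) (hy : y ∉ C) :
    UnsplitInv G A C T z .head := by
  have hjoin := fun q t => h.line_of_boundary (q := q) (t := t)
  have hpar := fun p q t => h.parent_boundary (p := p) (q := q) (t := t)
  rcases split_arrow_iff.1 hyz with hyz | ⟨hyT, hzT, hyz⟩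
  · have hO : G.Open A C z .head := by
      cases τ with
      | head =>
        by_cases hyT : y ∈ T
        · rcases ih.1 hyT with h' | ⟨q, hq, hqC, hnh⟩
          · exact .out h' hyz hy
          · exact .out (hnh.line (hjoin q y hq hyT) hqC) hyz hy
        · exact .out (ih.2.1 hyT) hyz hy
      | line => exact .out ih.1 hyz hy
      | tail =>
        by_cases hb : G.Boundary T y
        · exact ((ih.1 hb).resolve_left hy).1.out hyz hy
        · exact .out (ih.2 hb) hyz hy
    refine ⟨fun _ => Or.inl hO, fun _ => hO, fun hb t ht => ?_⟩
    have hyt := hpar y z t hb hyz ht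
    have hyb : ¬ G.Boundary T y := fun hyb => hyt.2 (hjoin y t hyb ht).2
    cases τ with
    | head =>
      by_cases hyT : y ∈ T
      · exact absurd (hjoin z y hb hyT).1 hyz.2
      · exact .out (ih.2.1 hyT) hyt hy
    | line => exact .out ih.1 hyt hy
    | tail => exact .out (ih.2 hyb) hyt hy
  · have hb : G.Boundary T y := ⟨hyT, z, hzT, hyz⟩
    refine ⟨fun _ => ?_, fun h => absurd hzT h, fun h => absurd hzT h.1⟩
    cases τ with
    | head => exact Or.inl (ih.2.2 hb z hzT)
    | line => exact Or.inr ⟨y, hb, hy, Or.inl ih.1⟩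
    | tail => exact Or.inr ⟨y, hb, hy, ((ih.1 hb).resolve_left hy).1⟩

theorem UnsplitInv.line (h : G.Splittable T) {y z : V} {τ : Mark}
    (ih : UnsplitInv G A C T y τ) (hyz : (G.split T).Line y z) (hy : y ∈ C ↔ τ = .head) :
    UnsplitInv G A C T z .line := by
  have hjoin := fun q t => h.line_of_boundary (q := q) (t := t)
  have hcomp := fun q q' => h.line_boundary (q := q) (q' := q')
  obtain ⟨hyz, hT⟩ := split_line_iff.1 hyz
  by_cases hyT : y ∈ T
  · have hnb : ¬ G.Boundary T y := fun h => h.1 hyT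
    cases τ with
    | head =>
      rcases ih.1 hyT with h' | ⟨q, hq, hqC, hnh⟩
      · exact ⟨.line h' hyz hy, fun _ q hq => Or.inl (.line h' (hjoin q y hq hyT).symm hy)⟩
      · refine ⟨hnh.line (hjoin q z hq (hT.1 hyT)) hqC, fun _ q' hq' => ?_⟩
        by_cases hqq : q = q'
        · exact hqq ▸ hnh
        · exact Or.inl (hnh.line (hcomp q q' hq hq' hqq) hqC)
    | line =>
      exact ⟨.line ih.1 hyz hy, fun _ q hq => Or.inl (.line ih.1 (hjoin q y hq hyT).symm hy)⟩
    | tail =>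
      exact ⟨.line (ih.2 hnb) hyz hy,
        fun _ q hq => Or.inl (.line (ih.2 hnb) (hjoin q y hq hyT).symm hy)⟩
  · refine ⟨?_, fun hz => absurd (hT.2 hz) hyT⟩
    cases τ with
    | head => exact .line (ih.2.1 hyT) hyz hy
    | line => exact .line ih.1 hyz hy
    | tail =>
      by_cases hb : G.Boundary T y
      · have hyC : y ∉ C := by simpa using hy
        exact ((ih.1 hb).resolve_left hyC).1.line hyz hyC
      · exact .line (ih.2 hb) hyz hy

theorem UnsplitInv.into (h : G.Splittable T) {y z : V} {τ : Mark}
    (ih : UnsplitInv G A C T y τ) (hyz : (G.split T).Arrow z y) (hy : y ∈ C ↔ τ ≠ .tail) :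
    UnsplitInv G A C T z .tail := by
  have hjoin := fun q t => h.line_of_boundary (q := q) (t := t)
  have hcomp := fun q q' => h.line_boundary (q := q) (q' := q')
  have hpar := fun p q t => h.parent_boundary (p := p) (q := q) (t := t)
  rcases split_arrow_iff.1 hyz with hzy | ⟨hzT, hyT, hzy⟩
  · have hO : G.Open A C z .tail := by
      cases τ with
      | head =>
        by_cases hyT : y ∈ T
        · rcases ih.1 hyT with h' | ⟨q, hq, hqC, hnh⟩
          · exact .into h' hzy hy
          · exact .into (hnh.line (hjoin q y hq hyT) hqC) hzy (by simpa using hy)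
        · exact .into (ih.2.1 hyT) hzy hy
      | line => exact .into ih.1 hzy hy
      | tail =>
        have hyC : y ∉ C := by simpa using hy
        by_cases hb : G.Boundary T y
        · exact ((ih.1 hb).resolve_left hyC).2 z hzy
        · exact .into (ih.2 hb) hzy hy
    refine ⟨fun _ => ?_, fun _ => hO⟩
    by_cases hzC : z ∈ C
    · exact Or.inl hzC
    · exact Or.inr ⟨Or.inr hO, fun p hp => .into hO hp (by simp [hzC])⟩
  · have hb : G.Boundary T z := ⟨hzT, y, hyT, hzy⟩
    refine ⟨fun _ => Or.inr ?_, fun h => absurd hb h⟩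
    have hnb : ¬ G.Boundary T y := fun h => h.1 hyT
    cases τ with
    | head =>
      rcases ih.1 hyT with h' | ⟨q, hq, hqC, hnh⟩
      · exact ⟨Or.inl (.line h' hzy.symm (by simpa using hy)),
          fun p hp => .into h' (hpar p z y hb hp hyT) hy⟩
      · constructor
        · by_cases hqz : q = z
          · exact hqz ▸ hnh
          · exact Or.inl (hnh.line (hcomp q z hq hb hqz) hqC)
        · exact fun p hp => .into (hnh.line (hjoin q y hq hyT) hqC) (hpar p z y hb hp hyT)
            (by simpa using hy)
    | line => exact ⟨ih.2 hyT z hb, fun p hp => .into ih.1 (hpar p z y hb hp hyT) hy⟩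
    | tail =>
      exact ⟨Or.inl (.line (ih.2 hnb) hzy.symm (by simpa using hy)),
        fun p hp => .into (ih.2 hnb) (hpar p z y hb hp hyT) hy⟩

theorem Splittable.unsplitInv (h : G.Splittable T) (hAC : Disjoint A C) {y : V} {τ : Mark}
    (ho : (G.split T).Open A C y τ) : UnsplitInv G A C T y τ := by
  induction ho with
  | @start a ha =>
    have haC : a ∉ C := Set.disjoint_left.1 hAC ha
    exact ⟨fun _ => Or.inr ⟨Or.inr (.start ha), fun z hz => .into (.start ha) hz (by simp [haC])⟩,
      fun _ => .start ha⟩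
  | out _ hyz hy ih => exact ih.out h hyz hy
  | line _ hyz hy ih => exact ih.line h hyz hy
  | into _ hyz hy ih => exact ih.into h hyz hy

theorem UnsplitInv.exists_open (h : G.Splittable T) {y : V} {τ : Mark}
    (hi : UnsplitInv G A C T y τ) (hy : y ∉ C) : ∃ τ, G.Open A C y τ := by
  cases τ with
  | head =>
    by_cases hyT : y ∈ T
    · rcases hi.1 hyT with h' | ⟨q, hq, hqC, hnh⟩
      · exact ⟨_, h'⟩
      · exact ⟨_, hnh.line (h.line_of_boundary hq hyT) hqC⟩
    · exact ⟨_, hi.2.1 hyT⟩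
  | line => exact ⟨_, hi.1⟩
  | tail =>
    by_cases hb : G.Boundary T y
    · exact ((hi.1 hb).resolve_left hy).1.elim (fun h => ⟨_, h⟩) fun h => ⟨_, h⟩
    · exact ⟨_, hi.2 hb⟩

/-- What a route of `G` that arrives at `q` by a line tells about routes of `G.split T`. -/
def BoundaryLineInv (G : MixedGraph V) (A C T : Set V) (q : V) : Prop :=
  (q ∉ C → (G.split T).OpenNonhead A C q) ∧
    (q ∈ C → ∀ z, G.Arrow z q → (G.split T).Open A C z .tail)

/-- What a route of `G` tells about routes of `G.split T`. -/
def SplitInv (G : MixedGraph V) (A C T : Set V) (y : V) : Mark → Prop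
  | .head => (G.split T).Open A C y .head ∧
      (G.Boundary T y → ∀ t ∈ T, (G.split T).Open A C t .head)
  | .line => (G.Boundary T y → BoundaryLineInv G A C T y) ∧
      (y ∈ T → (∀ q, G.Boundary T q → BoundaryLineInv G A C T q) ∧
        ((G.split T).Open A C y .line ∨ ∀ t ∈ T, (G.split T).Open A C t .head)) ∧
      (¬ G.Boundary T y → y ∉ T → (G.split T).Open A C y .line)
  | .tail => (G.split T).Open A C y .tail

/-- In this direction an arrival by a line, in `T` or on its boundary, may be available in the split
only with another mark. The invariant keeps what suffices to continue: heads at all of `T`, and at a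
boundary vertex a non-head arrival or, if it is in `C`, access to its parents. -/
theorem SplitInv.out (h : G.Splittable T) {y z : V} {τ : Mark}
    (ih : SplitInv G A C T y τ) (hyz : G.Arrow y z) (hy : y ∉ C) :
    SplitInv G A C T z .head := by
  have key : ∀ z, G.Arrow y z → (G.split T).Open A C z .head := by
    intro z hyz
    have hyz' : (G.split T).Arrow y z := split_arrow_iff.2 (Or.inl hyz)
    cases τ with
    | head => exact .out ih.1 hyz' hy
    | line =>
      by_cases hb : G.Boundary T y
      · exact ((ih.1 hb).1 hy).out hyz' hy
      · by_cases hyT : y ∈ T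
        · rcases (ih.2.1 hyT).2 with h' | h'
          · exact .out h' hyz' hy
          · exact .out (h' y hyT) hyz' hy
        · exact .out (ih.2.2 hb hyT) hyz' hy
    | tail => exact .out ih hyz' hy
  exact ⟨key z hyz, fun hb t ht => key t (h.parent_boundary hb hyz ht)⟩

theorem Splittable.split_arrow (h : G.Splittable T) {q t : V} (hq : G.Boundary T q)
    (ht : t ∈ T) : (G.split T).Arrow q t :=
  split_arrow_iff.2 (Or.inr ⟨hq.1, ht, h.line_of_boundary hq ht⟩)

theorem Splittable.split_line (h : G.Splittable T) {q q' : V} (hq : G.Boundary T q)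
    (hq' : G.Boundary T q') (hne : q ≠ q') : (G.split T).Line q q' :=
  split_line_iff.2 ⟨h.line_boundary hq hq' hne, by simp [hq.1, hq'.1]⟩

theorem boundaryLineInv_of_open {q : V} (ho : (G.split T).Open A C q .line) :
    BoundaryLineInv G A C T q :=
  ⟨fun _ => Or.inl ho, fun hq z hz =>
    .into ho (split_arrow_iff.2 (Or.inl hz)) (by simp [hq])⟩

/-- A vertex of `T` that may be left against arrows serves for all of the boundary. -/
theorem boundaryLineInv_of_tails (h : G.Splittable T) {q t : V} (hq : G.Boundary T q)
    (ht : t ∈ T) (ho : ∀ z, (G.split T).Arrow z t → (G.split T).Open A C z .tail) :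
    BoundaryLineInv G A C T q :=
  ⟨fun _ => Or.inr (ho q (h.split_arrow hq ht)),
    fun _ z hz => ho z (split_arrow_iff.2 (Or.inl (h.parent_boundary hq hz ht)))⟩

theorem SplitInv.line_of_nonhead (h : G.Splittable T) {q : V} (hq : G.Boundary T q)
    (hqC : q ∉ C) (ho : (G.split T).OpenNonhead A C q) {z : V} (hz : z ∈ T) :
    SplitInv G A C T z .line := by
  refine ⟨fun hb => absurd hz hb.1, fun _ => ⟨fun q' hq' => ?_, Or.inr fun t ht => ?_⟩,
    fun _ h => absurd hz h⟩
  · by_cases hne : q = q'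
    · subst hne
      exact ⟨fun _ => ho, fun h => absurd h hqC⟩
    · exact boundaryLineInv_of_open (ho.line (h.split_line hq hq' hne) hqC)
  · exact ho.out (h.split_arrow hq ht) hqC

theorem SplitInv.line (h : G.Splittable T) {y z : V} {τ : Mark}
    (ih : SplitInv G A C T y τ) (hyz : G.Line y z) (hy : y ∈ C ↔ τ = .head) :
    SplitInv G A C T z .line := by
  by_cases hyT : y ∈ T
  · have hnb : ¬ G.Boundary T y := fun h => h.1 hyT
    have hbz : z ∉ T → G.Boundary T z := fun hz => ⟨hz, y, hyT, hyz.symm⟩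
    cases τ with
    | head =>
      have hyC : y ∈ C := by simpa using hy
      have hb : ∀ q, G.Boundary T q → BoundaryLineInv G A C T q := fun q hq =>
        boundaryLineInv_of_tails h hq hyT fun z hz => .into ih.1 hz (by simp [hyC])
      exact ⟨hb z, fun hz => ⟨hb, Or.inl (.line ih.1 (split_line_iff.2 ⟨hyz, by simp [hyT, hz]⟩) hy)⟩,
        fun h1 h2 => absurd (hbz h2) h1⟩
    | line =>
      obtain ⟨hb, ho⟩ := ih.2.1 hyT
      refine ⟨hb z, fun hz => ⟨hb, ?_⟩, fun h1 h2 => absurd (hbz h2) h1⟩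
      exact ho.imp_left fun ho => .line ho (split_line_iff.2 ⟨hyz, by simp [hyT, hz]⟩) hy
    | tail =>
      have hyC : y ∉ C := by simpa using hy
      have hb : ∀ q, G.Boundary T q → BoundaryLineInv G A C T q := fun q hq =>
        boundaryLineInv_of_tails h hq hyT fun z hz => .into ih hz (by simp [hyC])
      exact ⟨hb z, fun hz => ⟨hb, Or.inl (.line ih (split_line_iff.2 ⟨hyz, by simp [hyT, hz]⟩) hy)⟩,
        fun h1 h2 => absurd (hbz h2) h1⟩
  · by_cases hz : z ∈ T
    · have hb : G.Boundary T y := ⟨hyT, z, hz, hyz⟩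
      cases τ with
      | head =>
        have hyC : y ∈ C := by simpa using hy
        refine ⟨fun hb => absurd hz hb.1, fun _ => ⟨fun q' hq' => ?_, Or.inr (ih.2 hb)⟩,
          fun _ h => absurd hz h⟩
        by_cases hne : y = q'
        · subst hne
          exact ⟨fun h => absurd hyC h, fun _ p hp =>
            .into ih.1 (split_arrow_iff.2 (Or.inl hp)) (by simp [hyC])⟩
        · exact boundaryLineInv_of_open (.line ih.1 (h.split_line hb hq' hne) hy)
      | line =>
        have hyC : y ∉ C := by simpa using hy
        exact SplitInv.line_of_nonhead h hb hyC ((ih.1 hb).1 hyC) hz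
      | tail =>
        have hyC : y ∉ C := by simpa using hy
        exact SplitInv.line_of_nonhead h hb hyC (Or.inr ih) hz
    · have hyz' : (G.split T).Line y z := split_line_iff.2 ⟨hyz, by simp [hyT, hz]⟩
      have hO : (G.split T).Open A C z .line := by
        cases τ with
        | head => exact .line ih.1 hyz' hy
        | line =>
          by_cases hb : G.Boundary T y
          · have hyC : y ∉ C := by simpa using hy
            exact ((ih.1 hb).1 hyC).line hyz' hyC
          · exact .line (ih.2.2 hb hyT) hyz' hy
        | tail => exact .line ih hyz' hy
      exact ⟨fun _ => boundaryLineInv_of_open hO, fun h => absurd h hz, fun _ _ => hO⟩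

theorem SplitInv.into {y z : V} {τ : Mark}
    (ih : SplitInv G A C T y τ) (hyz : G.Arrow z y) (hy : y ∈ C ↔ τ ≠ .tail) :
    SplitInv G A C T z .tail := by
  change (G.split T).Open A C z .tail
  have hyz' : (G.split T).Arrow z y := split_arrow_iff.2 (Or.inl hyz)
  cases τ with
  | head => exact .into ih.1 hyz' hy
  | line =>
    have hyC : y ∈ C := by simpa using hy
    by_cases hb : G.Boundary T y
    · exact (ih.1 hb).2 hyC z hyz
    · by_cases hyT : y ∈ T
      · rcases (ih.2.1 hyT).2 with h' | h'
        · exact .into h' hyz' hy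
        · exact .into (h' y hyT) hyz' (by simpa using hy)
      · exact .into (ih.2.2 hb hyT) hyz' hy
  | tail => exact .into ih hyz' hy

theorem Splittable.splitInv (h : G.Splittable T) {y : V} {τ : Mark}
    (ho : G.Open A C y τ) : SplitInv G A C T y τ := by
  induction ho with
  | start ha => exact .start ha
  | out _ hyz hy ih => exact ih.out h hyz hy
  | line _ hyz hy ih => exact ih.line h hyz hy
  | into _ hyz hy ih => exact ih.into hyz hy

theorem SplitInv.exists_open {y : V} {τ : Mark}
    (hi : SplitInv G A C T y τ) (hy : y ∉ C) : ∃ τ, (G.split T).Open A C y τ := by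
  cases τ with
  | head => exact ⟨_, hi.1⟩
  | line =>
    by_cases hb : G.Boundary T y
    · exact ((hi.1 hb).1 hy).elim (fun h => ⟨_, h⟩) fun h => ⟨_, h⟩
    · by_cases hyT : y ∈ T
      · rcases (hi.2.1 hyT).2 with h' | h'
        · exact ⟨_, h'⟩
        · exact ⟨_, h' y hyT⟩
      · exact ⟨_, hi.2.2 hb hyT⟩
  | tail => exact ⟨_, hi⟩

end Simulation

/-! ### All members have the same open connections -/

/-- Some vertex of `B` is at the end of an open route from `A`. -/
def Connects (G : MixedGraph V) (A B C : Set V) : Prop := ∃ b ∈ B, ∃ τ, G.Open A C b τ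

/-- The same open routes up to the choice of the route. -/
def RouteEquiv (G H : MixedGraph V) : Prop :=
  ∀ A B C : Set V, Disjoint A C → Disjoint B C → (G.Connects A B C ↔ H.Connects A B C)

theorem Splittable.routeEquiv {T : Set V} (h : G.Splittable T) : RouteEquiv (G.split T) G := by
  intro A B C hAC hBC
  constructor
  · rintro ⟨b, hb, τ, ho⟩
    exact ⟨b, hb, (h.unsplitInv hAC ho).exists_open h (Set.disjoint_left.1 hBC hb)⟩
  · rintro ⟨b, hb, τ, ho⟩
    exact ⟨b, hb, (h.splitInv ho).exists_open (Set.disjoint_left.1 hBC hb)⟩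

theorem RouteEquiv.refl (G : MixedGraph V) : RouteEquiv G G := fun _ _ _ _ _ => Iff.rfl

theorem RouteEquiv.symm (h : RouteEquiv G H) : RouteEquiv H G :=
  fun A B C h₁ h₂ => (h A B C h₁ h₂).symm

theorem RouteEquiv.trans {K : MixedGraph V} (h : RouteEquiv G H) (h' : RouteEquiv H K) :
    RouteEquiv G K :=
  fun A B C h₁ h₂ => (h A B C h₁ h₂).trans (h' A B C h₁ h₂)

/-- Both graphs are splits of the graph in which the arrow is replaced by a line. -/
theorem Covered.routeEquiv {v w : V} (h : G.Covered v w) :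
    RouteEquiv (G.flip v w h.ne) G := by
  have h1 := (merge_splittable_right h).routeEquiv
  have h2 := (merge_splittable_left h).routeEquiv
  rw [merge_split_right h] at h1
  rw [merge_split_left h] at h2
  exact h2.trans h1.symm

section Classes

variable {G₀ D E : MixedGraph V}

/-- Reversing a covered arrow on which `D` and `E` disagree lowers the number of disagreements; with
none left, the graphs are equal. -/
theorem routeEquiv_of_directed [Finite V] (hE : E ∈ directedMembers G₀) (n : ℕ) :
    ∀ D ∈ directedMembers G₀, {e : V × V | D.Arrow e.1 e.2 ∧ E.Arrow e.2 e.1}.ncard = n →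
      RouteEquiv D E := by
  induction n using Nat.strong_induction_on with
  | _ n ih =>
    intro D hD hn
    by_cases hne : ∃ v w, D.Arrow v w ∧ E.Arrow w v
    · obtain ⟨v₀, w₀, h₁, h₂⟩ := hne
      obtain ⟨v, w, hvw, hwv, -, hcov⟩ := exists_covered hD hE (S := Set.univ)
        (fun _ _ _ _ => trivial) ⟨v₀, w₀, h₁, h₂, trivial⟩
      refine hcov.routeEquiv.symm.trans (ih _ ?_ _ (hcov.flip_mem_directed hD) rfl)
      rw [← hn]
      refine Set.ncard_lt_ncard ((Set.ssubset_iff_of_subset ?_).2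
        ⟨(v, w), ⟨hvw, hwv⟩, fun h => h.1.2 hcov.flip_arrow.1⟩) (Set.toFinite _)
      rintro ⟨x, y⟩ ⟨h1, h2⟩
      refine ⟨?_, h2⟩
      rcases (flip_arrow_iff hcov).1 h1 with h | ⟨h, h'⟩
      · exact h.1
      · simp only at h h' h2
        subst h h'
        exact absurd h2.1 hwv.2
    · push Not at hne
      have : D = E := by
        have key : ∀ {D E : MixedGraph V}, D ∈ directedMembers G₀ → E ∈ directedMembers G₀ →
            (∀ v w, D.Arrow v w → ¬ E.Arrow w v) → ∀ a b, D.Edge a b → E.Edge a b := by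
          intro D E hD hE hne a b hab
          by_cases hba : D.Edge b a
          · exact ((line_iff_of_directed hD hE).1 ⟨hab, hba⟩).1
          · exact ((arrow_or_arrow hD hE ⟨hab, hba⟩).resolve_right (hne a b ⟨hab, hba⟩)).1
        ext a b
        exact ⟨key hD hE hne a b, key hE hD (fun v w h h' => hne w v h' h) a b⟩
      exact this ▸ RouteEquiv.refl _

/-- A member of the class that has a line which is not a line in all members can be split. -/
theorem exists_splittable [Finite V] (hG : G ∈ triplexClass G₀) (hD : D ∈ directedMembers G₀)
    (hab : G.Line a b) (hab' : D.Arrow a b) :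
    ∃ T : Set V, G.Splittable T ∧ ∃ q ∉ T, ∃ t ∈ T, G.Line q t := by
  have e := triplexEquiv_of_mem hG hD.1
  have hcG := hG.1
  have hcD := hD.1.1
  -- The set to split off is the chain component of `t` in `D`. By maximality of `t`, every line of
  -- `G` that crosses its border is an arrow of `D` into it.
  obtain ⟨t, ⟨u, hut, hut'⟩, hmax⟩ := Set.exists_max_image
    {t | ∃ u, G.Line u t ∧ D.Arrow u t} (fun t => (D.ant t).ncard) (Set.toFinite _)
    ⟨b, a, hab, hab'⟩
  have hTant : ∀ t' ∈ D.coherent {t}, D.ant t' = D.ant t := by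
    rintro t' ⟨_, rfl, h⟩
    induction h using Relation.ReflTransGen.head_induction_on with
    | refl => rfl
    | @head x y hxy _ ih =>
      rw [← ih]
      ext z
      exact ⟨fun h => Reach.trans h (Edge.reach hxy.1), fun h => Reach.trans h (Edge.reach hxy.2)⟩
  have hTline : ∀ x y, D.Line x y → y ∈ D.coherent {t} → x ∈ D.coherent {t} := by
    rintro x y hxy ⟨z, hz, h⟩
    exact ⟨z, hz, Relation.ReflTransGen.head hxy h⟩
  have htT : t ∈ D.coherent {t} := ⟨t, rfl, Relation.ReflTransGen.refl⟩
  have hqt : ∀ q ∉ D.coherent {t}, ∀ t' ∈ D.coherent {t}, G.Line q t' → D.Arrow q t' := by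
    intro q hq t' ht' hl
    rcases adj_iff_arrow_or_line.1 ((e.1 _ _).1 hl.adj) with h | h | h
    · exact h
    · exact absurd (hTline q t' h ht') hq
    · refine absurd (hmax q ⟨t', hl.symm, h⟩) (not_le.2 ?_)
      rw [← hTant t' ht']
      exact hcD.ncard_ant_lt h
  have hstep : ∀ q ∉ D.coherent {t}, ∀ t' ∈ D.coherent {t}, G.Line q t' → ∀ t'', D.Line t' t'' →
      G.Line q t'' := by
    intro q hq t' ht' hl t'' htt
    have h1 := hqt q hq t' ht' hl
    have hne : q ≠ t'' := by
      rintro rfl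
      exact h1.2 htt.1
    have hl' := hD.2 _ _ htt G hG
    refine hcG.line_trans hl hl' ?_
    by_contra hn
    have ht := (e.2 q t' t'').2 ⟨hne, fun h => hn ((e.1 _ _).2 h), h1.1, htt.2, Or.inl h1⟩
    exact ht.2.2.2.2.elim (fun h => h.2 hl.2) fun h => h.2 hl'.1
  have hjoin_t : ∀ q ∉ D.coherent {t}, ∀ t' ∈ D.coherent {t}, G.Line q t' → G.Line q t := by
    rintro q hq t' ⟨_, rfl, h⟩ hl
    induction h using Relation.ReflTransGen.head_induction_on with
    | refl => exact hl
    | @head x y hxy hyt ih =>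
      exact ih (hstep q hq x (hTline x y hxy ⟨_, rfl, hyt⟩) hl y hxy)
  refine ⟨D.coherent {t}, ⟨?_, ?_, ?_⟩, u, ?_, t, htT, hut⟩
  · rintro q hq t₁ ht₁ hl t' ⟨_, rfl, h⟩
    have hqt' := hjoin_t q hq t₁ ht₁ hl
    induction h using Relation.ReflTransGen.head_induction_on with
    | refl => exact hqt'
    | @head x y hxy hyt ih => exact hstep q hq y ⟨_, rfl, hyt⟩ ih x hxy.symm
  · intro q hq q' hq' t' ht' hl hl' hne
    have h1 := hqt q hq t' ht' hl
    have h2 := hqt q' hq' t' ht' hl'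
    refine hcG.line_trans hl hl'.symm ?_
    by_contra hn
    have ht := (e.2 q t' q').2 ⟨hne, fun h => hn ((e.1 _ _).2 h), h1.1, h2.1, Or.inl h1⟩
    exact ht.2.2.2.2.elim (fun h => h.2 hl.2) fun h => h.2 hl'.2
  · intro p q hq t' ht' hp hl
    have h1 := hqt q hq t' ht' hl
    refine hcG.arrow_trans_left hp hl.1 (e.adj_of_edges hp.1 hl.2 (Or.inl hp) ?_ (Or.inr h1.2))
    rintro rfl
    exact hp.2 hl.1
  · intro hu
    refine absurd (hcD.ncard_ant_lt hut') (not_lt.2 (le_of_eq ?_))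
    rw [hTant u hu]

/-- A line counts as two edge pairs and an arrow as one, so every proper split lowers the count. -/
theorem exists_directed_routeEquiv [Finite V] (n : ℕ) :
    ∀ G ∈ triplexClass G₀, {e : V × V | G.Edge e.1 e.2}.ncard = n →
      ∃ D ∈ directedMembers G₀, RouteEquiv G D := by
  induction n using Nat.strong_induction_on with
  | _ n ih =>
    intro G hG hn
    by_cases hGd : G ∈ directedMembers G₀
    · exact ⟨G, hGd, RouteEquiv.refl _⟩
    obtain ⟨D, hD⟩ := directedMembers_nonempty hG
    have hab : ∃ a b, G.Line a b ∧ D.Arrow a b := by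
      by_contra hno
      push Not at hno
      refine hGd ⟨hG, fun a b hab => hD.2 a b ?_⟩
      rcases adj_iff_arrow_or_line.1 (((triplexEquiv_of_mem hG hD.1).1 a b).1 hab.adj) with
        h | h | h
      · exact absurd h (hno a b hab)
      · exact h
      · exact absurd h (hno b a hab.symm)
    obtain ⟨a, b, hab, hab'⟩ := hab
    obtain ⟨T, hT, q, hq, t, ht, hqt⟩ := exists_splittable hG hD hab hab'
    have hlt : {e : V × V | (G.split T).Edge e.1 e.2}.ncard < n := by
      rw [← hn]
      refine Set.ncard_lt_ncard ((Set.ssubset_iff_of_subset fun e h => h.1).2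
        ⟨(t, q), hqt.2, fun h => h.2 ⟨ht, hq, hqt.1⟩⟩) (Set.toFinite _)
    obtain ⟨D', hD', h⟩ := ih _ hlt _ (hT.mem hG) rfl
    exact ⟨D', hD', hT.routeEquiv.symm.trans h⟩

theorem routeEquiv_of_mem [Finite V] (hG : G ∈ triplexClass G₀) (hH : H ∈ triplexClass G₀) :
    RouteEquiv G H := by
  obtain ⟨D, hD, h₁⟩ := exists_directed_routeEquiv _ G hG rfl
  obtain ⟨E, hE, h₂⟩ := exists_directed_routeEquiv _ H hH rfl
  exact h₁.trans ((routeEquiv_of_directed hE _ D hD rfl).trans h₂.symm)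

end Classes

/-! ### Separation in the augmented graph and open routes -/

section Extended

variable {S : Set V}

theorem subset_ancestors : S ⊆ G.ancestors S := fun a ha => ⟨a, ha, Relation.ReflTransGen.refl⟩

theorem subset_coherent : S ⊆ G.coherent S := fun a ha => ⟨a, ha, Relation.ReflTransGen.refl⟩

theorem mem_ancestors_of_arrow (h : G.Arrow a b) (hb : b ∈ G.ancestors S) : a ∈ G.ancestors S := by
  obtain ⟨s, hs, h'⟩ := hb
  exact ⟨s, hs, Relation.ReflTransGen.head h h'⟩

theorem mem_coherent_of_line (h : G.Line a b) (hb : b ∈ G.coherent S) : a ∈ G.coherent S := by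
  obtain ⟨s, hs, h'⟩ := hb
  exact ⟨s, hs, Relation.ReflTransGen.head h h'⟩

theorem extended_arrow_iff : (G.extended S).Arrow a b ↔ G.Arrow a b ∧ b ∈ G.ancestors S := by
  constructor
  · rintro ⟨⟨h, ha, hb⟩ | ⟨h, ha, hb⟩, hn⟩
    · exact ⟨⟨h, fun h' => hn (Or.inl ⟨h', hb, ha⟩)⟩, hb⟩
    · exact absurd (Or.inr ⟨h.symm, hb, ha⟩) hn
  · rintro ⟨h, hb⟩
    refine ⟨Or.inl ⟨h.1, mem_ancestors_of_arrow h hb, hb⟩, ?_⟩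
    rintro (⟨h', -⟩ | ⟨h', -⟩)
    · exact h.2 h'
    · exact h.2 h'.1

theorem extended_line_iff :
    (G.extended S).Line a b ↔ G.Line a b ∧ a ∈ G.coherent (G.ancestors S) := by
  constructor
  · rintro ⟨⟨h, ha, hb⟩ | ⟨h, ha, hb⟩, h'⟩
    · refine ⟨⟨h, ?_⟩, subset_coherent ha⟩
      rcases h' with h' | h'
      · exact h'.1
      · exact h'.1.1
    · exact ⟨h, ha⟩
  · rintro ⟨h, ha⟩
    have hb := mem_coherent_of_line h.symm ha
    exact ⟨Or.inr ⟨h, ha, hb⟩, Or.inr ⟨h.symm, hb, ha⟩⟩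

theorem adj_of_extended (h : (G.extended S).Adj a b) : G.Adj a b := by
  rcases adj_iff_arrow_or_line.1 h with h | h | h
  · exact (extended_arrow_iff.1 h).1.adj
  · exact (extended_line_iff.1 h).1.adj
  · exact (extended_arrow_iff.1 h).1.adj.symm

theorem augmented_adj_iff : H.augmented.Adj a b ↔ a ≠ b ∧
    (H.Adj a b ∨ (∃ c, H.Triplex a c b) ∨ ∃ c d, H.Biflag a b c d) := by
  rw [augmented, SimpleGraph.fromRel_adj]
  refine and_congr_right fun _ => ⟨?_, Or.inl⟩
  rintro (h | h | ⟨c, h⟩ | ⟨c, d, h⟩)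
  · exact h
  · exact Or.inl h.symm
  · exact Or.inr (Or.inl ⟨c, h.symm⟩)
  · exact Or.inr (Or.inr ⟨d, c, h.2.2.1, h.2.1.symm, h.1, h.2.2.2.2, h.2.2.2.1⟩)

theorem augmented_adj_of_adj (h : H.Adj a b) : H.augmented.Adj a b :=
  augmented_adj_iff.2 ⟨h.ne, Or.inl h⟩

theorem augmented_adj_of_edges (hab : H.Edge a b) (hcb : H.Edge c b)
    (h : H.Arrow a b ∨ H.Arrow c b) : a = c ∨ H.augmented.Adj a c := by
  by_cases hne : a = c
  · exact Or.inl hne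
  by_cases hac : H.Adj a c
  · exact Or.inr (augmented_adj_of_adj hac)
  · exact Or.inr (augmented_adj_iff.2 ⟨hne, Or.inr (Or.inl ⟨b, hne, hac, hab, hcb, h⟩)⟩)

end Extended

section Routes

variable {A B C : Set V}

/-- If a vertex above `A ∪ B ∪ C` is reached, then it is also reached from below, unless `B` is. -/
theorem Open.tail_of_ancestor {w : V} {τ : Mark} (h : G.Open A C w τ) (hw : w ∉ C)
    (han : w ∈ G.ancestors (A ∪ B ∪ C)) : G.Connects A B C ∨ G.Open A C w .tail := by
  -- Descend along the directed path and come back up: at the first vertex `y ∈ C` the route turns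
  -- by the collider `→ y ←`, and in `A` a new route starts.
  obtain ⟨s, hs, hws⟩ := han
  induction hws using Relation.ReflTransGen.head_induction_on generalizing τ with
  | refl =>
    rcases hs with (hs | hs) | hs
    · exact Or.inr (.start hs)
    · exact Or.inl ⟨s, hs, τ, h⟩
    · exact absurd hs hw
  | @head w y hwy _ ih =>
    by_cases hy : y ∈ C
    · exact Or.inr (.into (.out h hwy hw) hwy (by simp [hy]))
    · exact (ih (.out h hwy hw) hy).imp id fun h' => .into h' hwy (by simp [hy])

/-- A vertex reached such that the route can be continued along every edge. -/
def Flexible (G : MixedGraph V) (A B C : Set V) (w : V) : Prop :=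
  G.Open A C w .tail ∨ (G.Open A C w .line ∧ w ∉ G.ancestors (A ∪ B ∪ C))

theorem Open.flexible {w : V} {τ : Mark} (h : G.Open A C w τ) (hw : w ∉ C)
    (hτ : τ = .head → w ∈ G.ancestors (A ∪ B ∪ C)) :
    G.Connects A B C ∨ G.Flexible A B C w := by
  by_cases han : w ∈ G.ancestors (A ∪ B ∪ C)
  · exact (h.tail_of_ancestor hw han).imp id Or.inl
  · cases τ with
    | head => exact absurd (hτ rfl) han
    | line => exact Or.inr (Or.inr ⟨h, han⟩)
    | tail => exact Or.inr (Or.inl h)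

theorem Flexible.line {w z : V} (h : G.Flexible A B C w) (hw : w ∉ C) (hwz : G.Line w z) :
    G.Open A C z .line :=
  h.elim (fun h => .line h hwz (by simp [hw])) fun h => .line h.1 hwz (by simp [hw])

theorem Flexible.tail {w : V} (h : G.Flexible A B C w) (han : w ∈ G.ancestors (A ∪ B ∪ C)) :
    G.Open A C w .tail :=
  h.resolve_right fun h => h.2 han

theorem Open.through_head {y : V} (h : G.Open A C y .head)
    (han : y ∈ G.ancestors (A ∪ B ∪ C)) : G.Connects A B C ∨
      ((∀ z, G.Line y z → G.Open A C z .line) ∧ ∀ z, G.Arrow z y → G.Open A C z .tail) := by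
  by_cases hy : y ∈ C
  · exact Or.inr ⟨fun z hz => .line h hz (by simp [hy]), fun z hz => .into h hz (by simp [hy])⟩
  · exact (h.tail_of_ancestor hy han).imp id fun h =>
      ⟨fun z hz => .line h hz (by simp [hy]), fun z hz => .into h hz (by simp [hy])⟩

theorem Open.through_line {y : V} (h : G.Open A C y .line)
    (han : y ∈ G.ancestors (A ∪ B ∪ C)) : G.Connects A B C ∨
      ∀ z, G.Arrow z y → G.Open A C z .tail := by
  by_cases hy : y ∈ C
  · exact Or.inr fun z hz => .into h hz (by simp [hy])
  · exact (h.tail_of_ancestor hy han).imp id fun h z hz => .into h hz (by simp [hy])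

/-- A triplex is crossed through its middle vertex and a 2-biflag through its two middle vertices.
Heads of arrows in the extended subgraph are ancestors of `A ∪ B ∪ C`, so these vertices can be
passed as colliders, possibly after a detour downwards. -/
theorem Flexible.step {w z : V} (h : G.Flexible A B C w) (hw : w ∉ C) (hz : z ∉ C)
    (hwz : (G.extended (A ∪ B ∪ C)).augmented.Adj w z) :
    G.Connects A B C ∨ G.Flexible A B C z := by
  obtain ⟨-, hadj | ⟨y, ht⟩ | ⟨x, y, hb⟩⟩ := augmented_adj_iff.1 hwz
  · rcases adj_iff_arrow_or_line.1 hadj with h' | h' | h'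
    · obtain ⟨h1, h2⟩ := extended_arrow_iff.1 h'
      exact Open.flexible (.out (h.tail (mem_ancestors_of_arrow h1 h2)) h1 hw) hz fun _ => h2
    · exact Open.flexible (h.line hw (extended_line_iff.1 h').1) hz (by simp)
    · obtain ⟨h1, h2⟩ := extended_arrow_iff.1 h'
      exact Open.flexible (.into (h.tail h2) h1 (by simp [hw])) hz (by simp)
  · by_cases hwy : (G.extended (A ∪ B ∪ C)).Edge y w
    · have hl := (extended_line_iff.1 ⟨ht.2.2.1, hwy⟩).1
      obtain ⟨h1, h2⟩ := extended_arrow_iff.1 (ht.2.2.2.2.resolve_left fun h => h.2 hwy)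
      rcases (h.line hw hl).through_line h2 with h' | h'
      · exact Or.inl h'
      · exact Open.flexible (h' z h1) hz (by simp)
    · obtain ⟨h1, h2⟩ := extended_arrow_iff.1 ⟨ht.2.2.1, hwy⟩
      have ho : G.Open A C y .head := .out (h.tail (mem_ancestors_of_arrow h1 h2)) h1 hw
      rcases ho.through_head h2 with h' | ⟨h', h''⟩
      · exact Or.inl h'
      · by_cases hyz : (G.extended (A ∪ B ∪ C)).Edge y z
        · exact Open.flexible (h' z (extended_line_iff.1 ⟨hyz, ht.2.2.2.1⟩).1) hz (by simp)
        · exact Open.flexible (h'' z (extended_arrow_iff.1 ⟨ht.2.2.2.1, hyz⟩).1) hz (by simp)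
  · obtain ⟨hwx, hxy, hzy, -, -⟩ := hb
    obtain ⟨h1, h2⟩ := extended_arrow_iff.1 hwx
    obtain ⟨h3, h4⟩ := extended_arrow_iff.1 hzy
    have ho : G.Open A C x .head := .out (h.tail (mem_ancestors_of_arrow h1 h2)) h1 hw
    rcases ho.through_head h2 with h' | ⟨h', -⟩
    · exact Or.inl h'
    · rcases (h' y (extended_line_iff.1 hxy).1).through_line h4 with h' | h'
      · exact Or.inl h'
      · exact Open.flexible (h' z h3) hz (by simp)

theorem connects_of_not_separates
    (h : ¬ Separates (G.extended (A ∪ B ∪ C)).augmented A B C) : G.Connects A B C := by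
  unfold Separates at h
  push Not at h
  obtain ⟨a, ha, b, hb, p, hp⟩ := h
  have key : ∀ w b (p : (G.extended (A ∪ B ∪ C)).augmented.Walk w b), b ∈ B →
      (∀ c ∈ C, c ∉ p.support) → G.Flexible A B C w → G.Connects A B C := by
    intro w b p hb
    induction p with
    | nil =>
      intro _ hw
      exact hw.elim (fun h => ⟨_, hb, _, h⟩) fun h => ⟨_, hb, _, h.1⟩
    | @cons w z b hwz p ih =>
      intro hC hw
      have h1 : w ∉ C := fun h => hC w h (by simp)
      have h2 : z ∉ C := fun h => hC z h (by simp)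
      rcases hw.step h1 h2 hwz with h' | h'
      · exact h'
      · exact ih hb (fun c hc h => hC c hc (by simp [h])) h'
  exact key a b p hb hp (Or.inl (.start ha))

/-- A walk to `B` outside `C` in the augmented graph. -/
def WalkTo (U : SimpleGraph V) (B C : Set V) (w : V) : Prop :=
  ∃ b ∈ B, ∃ p : U.Walk w b, ∀ c ∈ C, c ∉ p.support

theorem WalkTo.cons {U : SimpleGraph V} {w z : V} (hz : WalkTo U B C z) (hw : w ∉ C)
    (h : w = z ∨ U.Adj w z) : WalkTo U B C w := by
  rcases h with rfl | h
  · exact hz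
  · obtain ⟨b, hb, p, hp⟩ := hz
    refine ⟨b, hb, .cons h p, fun c hc h' => ?_⟩
    rcases List.mem_cons.1 (by simpa using h') with rfl | h'
    · exact hw hc
    · exact hp c hc h'

/-- A route that has arrived by a line can be continued to a walk to `B`. -/
def LineContinues (G : MixedGraph V) (U : SimpleGraph V) (B C : Set V) (z : V) : Prop :=
  (z ∉ C ∧ WalkTo U B C z) ∨ (z ∈ C ∧ ∃ w, w ∉ C ∧ G.Arrow w z ∧ WalkTo U B C w)

/-- A route that has arrived with the given mark can be continued to a walk to `B`. -/
def Continues (G : MixedGraph V) (U : SimpleGraph V) (S B C : Set V) (y : V) : Mark → Prop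
  | .head => y ∈ G.ancestors S ∧ ((y ∉ C ∧ WalkTo U B C y) ∨
      (y ∈ C ∧ ∃ z, z ∉ C ∧ G.Arrow z y ∧ WalkTo U B C z) ∨
      (y ∈ C ∧ ∃ z, G.Line y z ∧ LineContinues G U B C z))
  | .line => LineContinues G U B C y
  | .tail => WalkTo U B C y

/-- Traced backwards, such an arrival leads through lines and against-arrow steps to the start in
`A` or to a collider in `C`. -/
theorem Open.mem_extended {y : V} {τ : Mark} (h : G.Open A C y τ) :
    (τ = .tail → y ∈ G.ancestors (A ∪ B ∪ C)) ∧
      (τ = .line → y ∈ G.coherent (G.ancestors (A ∪ B ∪ C))) := by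
  have hC : ∀ y ∈ C, y ∈ G.ancestors (A ∪ B ∪ C) := fun y hy => subset_ancestors (Or.inr hy)
  induction h with
  | start ha => exact ⟨fun _ => subset_ancestors (Or.inl (Or.inl ha)), by simp⟩
  | out _ _ _ _ => exact ⟨by simp, by simp⟩
  | @line y z τ _ hyz hy ih =>
    refine ⟨by simp, fun _ => mem_coherent_of_line hyz.symm ?_⟩
    cases τ with
    | head => exact subset_coherent (hC y (hy.2 rfl))
    | line => exact ih.2 rfl
    | tail => exact subset_coherent (ih.1 rfl)
  | @into y z τ _ hyz hy ih =>
    refine ⟨fun _ => mem_ancestors_of_arrow hyz ?_, by simp⟩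
    cases τ with
    | head => exact hC y (hy.2 (by simp))
    | line => exact hC y (hy.2 (by simp))
    | tail => exact ih.1 rfl

theorem continues_of_walkTo {U : SimpleGraph V} {S : Set V} {y : V} {τ : Mark}
    (h : WalkTo U B C y) (hy : y ∉ C) (hS : τ = .head → y ∈ G.ancestors S) :
    G.Continues U S B C y τ := by
  cases τ with
  | head => exact ⟨hS rfl, Or.inl ⟨hy, h⟩⟩
  | line => exact Or.inl ⟨hy, h⟩
  | tail => exact h

/-- If one of the diagonals is an edge, adicyclicity makes it an arrow into the line, and the two
parents then meet at a common child. -/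
theorem augmented_adj_of_biflag (hG : G.IsChainGraph) {S : Set V} {y z u w : V}
    (hyz : (G.extended S).Arrow y z) (hzu : (G.extended S).Line z u)
    (hwu : (G.extended S).Arrow w u) : y = w ∨ (G.extended S).augmented.Adj y w := by
  obtain ⟨h1, h2⟩ := extended_arrow_iff.1 hyz
  obtain ⟨h3, h4⟩ := extended_arrow_iff.1 hwu
  have hl := (extended_line_iff.1 hzu).1
  by_cases hyu : (G.extended S).Adj y u
  · have h5 := extended_arrow_iff.2 ⟨hG.arrow_trans_left h1 hl.1 (adj_of_extended hyu), h4⟩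
    exact augmented_adj_of_edges h5.1 hwu.1 (Or.inl h5)
  by_cases hwz : (G.extended S).Adj w z
  · have h5 := extended_arrow_iff.2 ⟨hG.arrow_trans_left h3 hl.2 (adj_of_extended hwz), h2⟩
    exact augmented_adj_of_edges hyz.1 h5.1 (Or.inl hyz)
  by_cases hne : y = w
  · exact Or.inl hne
  exact Or.inr (augmented_adj_iff.2 ⟨hne, Or.inr (Or.inr ⟨z, u, hyz, hzu, hwu, hyu, hwz⟩)⟩)

/-- Dropping the vertices in `C` from an open route leaves a walk of the augmented graph. They are
colliders, so they occur singly, which gives a triplex or a shortcut, or as two joined by a line, `→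
- ←`, which gives the 2-biflag case. -/
theorem Continues.exists_walk (hG : G.IsChainGraph) {y : V} {τ : Mark}
    (h : G.Open A C y τ)
    (hc : G.Continues (G.extended (A ∪ B ∪ C)).augmented (A ∪ B ∪ C) B C y τ) :
    ∃ a ∈ A, WalkTo (G.extended (A ∪ B ∪ C)).augmented B C a := by
  have hC : ∀ y ∈ C, y ∈ G.ancestors (A ∪ B ∪ C) := fun y hy => subset_ancestors (Or.inr hy)
  induction h with
  | @start a ha => exact ⟨a, ha, hc⟩
  | @out y z τ _ hyz hy ih =>
    apply ih
    obtain ⟨hz, hc⟩ := hc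
    have hX := extended_arrow_iff.2 ⟨hyz, hz⟩
    refine continues_of_walkTo ?_ hy fun _ => mem_ancestors_of_arrow hyz hz
    rcases hc with ⟨-, hw⟩ | ⟨hzC, w, -, hwz, hw⟩ | ⟨hzC, u, hzu, ⟨huC, hu⟩ | ⟨huC, w, -, hwu, hw⟩⟩
    · exact hw.cons hy (Or.inr (augmented_adj_of_adj hX.adj))
    · have hX' := extended_arrow_iff.2 ⟨hwz, hz⟩
      exact hw.cons hy (augmented_adj_of_edges hX.1 hX'.1 (Or.inl hX))
    · have hX' := extended_line_iff.2 ⟨hzu, subset_coherent hz⟩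
      exact hu.cons hy (augmented_adj_of_edges hX.1 hX'.2 (Or.inl hX))
    · have hX' := extended_line_iff.2 ⟨hzu, subset_coherent hz⟩
      exact hw.cons hy (augmented_adj_of_biflag hG hX hX' (extended_arrow_iff.2 ⟨hwu, hC u huC⟩))
  | @line y z τ ho hyz hy ih =>
    apply ih
    by_cases hyC : y ∈ C
    · obtain rfl := hy.1 hyC
      exact ⟨hC y hyC, Or.inr (Or.inr ⟨hyC, z, hyz, hc⟩)⟩
    have hτ : τ ≠ .head := fun h => hyC (hy.2 h)
    have hm := ho.mem_extended (B := B)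
    have hco : y ∈ G.coherent (G.ancestors (A ∪ B ∪ C)) := by
      cases τ with
      | head => exact absurd rfl hτ
      | line => exact hm.2 rfl
      | tail => exact subset_coherent (hm.1 rfl)
    have hX := extended_line_iff.2 ⟨hyz, hco⟩
    refine continues_of_walkTo ?_ hyC fun h => absurd h hτ
    rcases hc with ⟨-, hw⟩ | ⟨hzC, w, -, hwz, hw⟩
    · exact hw.cons hyC (Or.inr (augmented_adj_of_adj hX.adj))
    · have hX' := extended_arrow_iff.2 ⟨hwz, hC z hzC⟩
      exact hw.cons hyC (augmented_adj_of_edges hX.1 hX'.1 (Or.inr hX'))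
  | @into y z τ ho hzy hy ih =>
    apply ih
    have hz : z ∉ C := by
      obtain ⟨b, hb, p, hp⟩ := hc
      exact fun h => hp z h (by simp)
    cases τ with
    | head =>
      have hyC := hy.2 (by simp)
      exact ⟨hC y hyC, Or.inr (Or.inl ⟨hyC, z, hz, hzy, hc⟩)⟩
    | line => exact Or.inr ⟨hy.2 (by simp), z, hz, hzy, hc⟩
    | tail =>
      have hyC : y ∉ C := by simpa using hy
      have hX := extended_arrow_iff.2 ⟨hzy, (ho.mem_extended (B := B)).1 rfl⟩
      exact WalkTo.cons hc hyC (Or.inr (augmented_adj_of_adj hX.adj.symm))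

theorem separates_iff (hG : G.IsChainGraph) (hBC : Disjoint B C) :
    Separates (G.extended (A ∪ B ∪ C)).augmented A B C ↔ ¬ G.Connects A B C := by
  constructor
  · rintro hs ⟨b, hb, τ, ho⟩
    have hbC : b ∉ C := Set.disjoint_left.1 hBC hb
    have hw : WalkTo (G.extended (A ∪ B ∪ C)).augmented B C b :=
      ⟨b, hb, .nil, fun c hc h => by
        rw [SimpleGraph.Walk.support_nil, List.mem_singleton] at h
        exact hbC (h ▸ hc)⟩
    obtain ⟨a, ha, b', hb', p, hp⟩ := Continues.exists_walk (B := B) hG ho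
      (continues_of_walkTo hw hbC fun _ => subset_ancestors (Or.inl (Or.inr hb)))
    obtain ⟨c, hc, hc'⟩ := hs a ha b' hb' p
    exact hp c hc hc'
  · intro h
    by_contra hs
    exact h (connects_of_not_separates hs)

end Routes

theorem markovEquiv_of_triplexEquiv [Finite V] (hG : G.IsChainGraph) (hH : H.IsChainGraph)
    (h : TriplexEquiv G H) : MarkovEquiv G H := by
  intro X _ _
  have hr : RouteEquiv G H := routeEquiv_of_mem (G₀ := H) ⟨hG, h⟩ ⟨hH, TriplexEquiv.refl H⟩
  ext P
  refine forall_congr' fun A => forall_congr' fun B => forall_congr' fun C =>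
    imp_congr_right fun _ => imp_congr_right fun hAC => imp_congr_right fun hBC => ?_
  rw [separates_iff hG hBC, separates_iff hH hBC, hr A B C hAC hBC]

/-! ### Separators of nonadjacent vertices -/

section Separation

/-- A vertex is separated by its parents from the vertices that it does not reach and to which it
is not adjacent. -/
theorem not_connects_parents (hG : G.IsChainGraph) (hca : ¬ G.Reach c a) (hadj : ¬ G.Adj a c) :
    ¬ G.Connects {c} {a} {p | G.Arrow p c} := by
  rintro ⟨x, hx, τ, ho⟩
  rw [Set.mem_singleton_iff.1 hx] at ho
  -- An open route from `c` stays among the vertices reached from `c`, or ends at a parent of `c`: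
  -- this is in the separator and is reached against an arrow, so the route cannot go on.
  have key : ∀ y τ, G.Open {c} {p | G.Arrow p c} y τ →
      (G.Reach c y ∧ (τ = .tail → y = c)) ∨ (G.Arrow y c ∧ τ = .tail) := by
    intro y τ ho
    have hno : ∀ y, G.Reach c y → ¬ G.Arrow y c := fun y h h' => hG.not_reach h' h
    induction ho with
    | start ha =>
      obtain rfl := ha
      exact Or.inl ⟨Reach.refl _, fun _ => rfl⟩
    | @out y z τ _ hyz hy ih =>
      rcases ih with ⟨h, -⟩ | ⟨h, -⟩
      · exact Or.inl ⟨h.trans (Edge.reach hyz.1), by simp⟩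
      · exact absurd h hy
    | @line y z τ _ hyz hy ih =>
      rcases ih with ⟨h, -⟩ | ⟨h, rfl⟩
      · exact Or.inl ⟨h.trans (Edge.reach hyz.1), by simp⟩
      · simpa using hy.1 h
    | @into y z τ _ hzy hy ih =>
      rcases ih with ⟨h, h'⟩ | ⟨h, rfl⟩
      · have hτ : τ = .tail := by
          by_contra hτ
          exact hno y h (hy.2 hτ)
        obtain rfl := h' hτ
        exact Or.inr ⟨hzy, rfl⟩
      · exact absurd rfl (hy.1 h)
  rcases key a τ ho with h | h
  · exact hca h.1
  · exact hadj h.1.adj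

/-- Two nonadjacent vertices of a chain component are separated by the other vertices that reach
the component. -/
theorem not_connects_component (hG : G.IsChainGraph) (hac : G.Reach a c) (hca : G.Reach c a)
    (hne : a ≠ c) (hadj : ¬ G.Adj a c) :
    ¬ G.Connects {a} {c} {x | G.Reach x a ∧ x ≠ a ∧ x ≠ c} := by
  rintro ⟨x, hx, τ, ho⟩
  rw [Set.mem_singleton_iff.1 hx] at ho
  -- Routes that go down never meet a vertex that reaches `a` again by a forward step, and cannot
  -- turn outside the separator. Line neighbours of `a` are in the separator and can be left only
  -- towards a parent, where the route is stuck.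
  have key : ∀ y τ, G.Open {a} {x | G.Reach x a ∧ x ≠ a ∧ x ≠ c} y τ →
      (y = a ∧ τ = .tail) ∨ (¬ G.Reach y a ∧ τ = .head) ∨
      (G.Reach y a ∧ G.Reach a y ∧ y ≠ a ∧ y ≠ c ∧ τ = .line) ∨
      (G.Reach y a ∧ y ≠ a ∧ y ≠ c ∧ τ = .tail) := by
    intro y τ ho
    induction ho with
    | start ha => exact Or.inl ⟨ha, rfl⟩
    | @out y z τ _ hyz hy ih =>
      rcases ih with ⟨rfl, rfl⟩ | ⟨h, rfl⟩ | ⟨h1, -, h2, h3, rfl⟩ | ⟨h1, h2, h3, rfl⟩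
      · exact Or.inr (Or.inl ⟨hG.not_reach hyz, rfl⟩)
      · exact Or.inr (Or.inl ⟨fun h' => h ((Edge.reach hyz.1).trans h'), rfl⟩)
      · exact absurd ⟨h1, h2, h3⟩ hy
      · exact absurd ⟨h1, h2, h3⟩ hy
    | @line y z τ _ hyz hy ih =>
      rcases ih with ⟨rfl, rfl⟩ | ⟨h, rfl⟩ | ⟨h1, -, h2, h3, rfl⟩ | ⟨h1, h2, h3, rfl⟩
      · refine Or.inr (Or.inr (Or.inl ⟨Edge.reach hyz.2, Edge.reach hyz.1, hyz.adj.ne.symm,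
          ?_, rfl⟩))
        rintro rfl
        exact hadj hyz.adj
      · exact absurd (hy.2 rfl).1 h
      · simpa using hy.1 ⟨h1, h2, h3⟩
      · simpa using hy.1 ⟨h1, h2, h3⟩
    | @into y z τ _ hzy hy ih =>
      have aux : G.Reach y a → G.Reach a y → G.Reach z a ∧ z ≠ a ∧ z ≠ c := by
        intro h1 h2
        refine ⟨(Edge.reach hzy.1).trans h1, ?_, ?_⟩
        · rintro rfl
          exact hG.not_reach hzy h1
        · rintro rfl
          exact hG.not_reach hzy (h1.trans hac)
      rcases ih with ⟨rfl, rfl⟩ | ⟨h, rfl⟩ | ⟨h1, h1', h2, h3, rfl⟩ | ⟨h1, h2, h3, rfl⟩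
      · obtain ⟨h1, h2, h3⟩ := aux (Reach.refl _) (Reach.refl _)
        exact Or.inr (Or.inr (Or.inr ⟨h1, h2, h3, rfl⟩))
      · exact absurd (hy.2 (by simp)).1 h
      · obtain ⟨h4, h5, h6⟩ := aux h1 h1'
        exact Or.inr (Or.inr (Or.inr ⟨h4, h5, h6, rfl⟩))
      · exact absurd rfl (hy.1 ⟨h1, h2, h3⟩)
  rcases key c τ ho with h | h | h | h
  · exact hne h.1.symm
  · exact h.1 hca
  · exact h.2.2.2.1 rfl
  · exact h.2.2.1 rfl

/-- Nonadjacent vertices can be separated, without the middle vertices of triplexes. -/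
theorem exists_separator (hG : G.IsChainGraph) (hne : a ≠ c) (hadj : ¬ G.Adj a c) :
    ∃ C : Set V, a ∉ C ∧ c ∉ C ∧ (∀ b, G.Triplex a b c → b ∉ C) ∧
      (¬ G.Connects {a} {c} C ∨ ¬ G.Connects {c} {a} C) := by
  by_cases hca : G.Reach c a
  · by_cases hac : G.Reach a c
    · refine ⟨{x | G.Reach x a ∧ x ≠ a ∧ x ≠ c}, by simp, by simp, ?_,
        Or.inl (not_connects_component hG hac hca hne hadj)⟩
      rintro b ht ⟨hb, -, -⟩
      rcases ht.2.2.2.2 with h | h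
      · exact hG.not_reach h hb
      · exact hG.not_reach h (hb.trans hac)
    · exact ⟨{p | G.Arrow p a}, fun h => G.irrefl a h.1, fun h => hadj h.adj.symm,
        fun b ht h => h.2 ht.2.2.1,
        Or.inl (not_connects_parents hG hac fun h => hadj h.symm)⟩
  · exact ⟨{p | G.Arrow p c}, fun h => hadj h.adj, fun h => G.irrefl c h.1,
      fun b ht h => h.2 ht.2.2.2.1, Or.inr (not_connects_parents hG hca hadj)⟩

end Separation

end MixedGraph

/-! ### One coin shown by several vertices -/

theorem ProbabilityTheory.condIndepFun_of_ae_eq_left {Ω β γ : Type*} {m' mΩ : MeasurableSpace Ω}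
    [StandardBorelSpace Ω] {hm' : m' ≤ mΩ} {μ : Measure Ω} [IsFiniteMeasure μ]
    [MeasurableSpace β] [MeasurableSpace γ] {f h : Ω → β} {g : Ω → γ} (hf : Measurable f)
    (hg : Measurable g) (hh : Measurable[m'] h) (hfh : f =ᵐ[μ] h) : CondIndepFun m' hm' f g μ := by
  have key : ∀ s : Set Ω, ∀ t : Set Ω, s =ᵐ[μ] t →
      (μ[s.indicator fun _ => (1 : ℝ) | m']) =ᵐ[μ] μ[t.indicator fun _ => (1 : ℝ) | m'] :=
    fun s t hst => condExp_congr_ae (indicator_ae_eq_of_ae_eq_set hst)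
  -- A function measurable for the conditioning σ-algebra is conditionally independent of
  -- everything, and the conditional expectations see `f` only up to null sets.
  have h1 : CondIndepFun m' hm' h g μ := condIndepFun_of_measurable_left hh hg
  rw [condIndepFun_iff_condExp_inter_preimage_eq_mul (hh.mono hm' le_rfl) hg] at h1
  rw [condIndepFun_iff_condExp_inter_preimage_eq_mul hf hg]
  intro s t hs ht
  have hst : f ⁻¹' s =ᵐ[μ] h ⁻¹' s := by
    filter_upwards [hfh] with x hx
    exact congrArg (fun y => y ∈ s) hx
  filter_upwards [h1 s t hs ht, key _ _ hst, key _ _ (hst.inter (ae_eq_refl (g ⁻¹' t)))]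
    with x h2 h3 h4
  rw [h4, h2, h3]

namespace MixedGraph

variable {V : Type*} {G H : MixedGraph V} {a b c d : V}

section TwoPoint

open scoped Classical in
/-- The indicator function of `K`. -/
noncomputable def boolIndicator (K : Set V) : V → Bool := fun v => decide (v ∈ K)

/-- The law of `|V|` coins of which those in `K` all show the result of one fair toss, and the
others are constant. -/
noncomputable def twoPointMeasure (K : Set V) : Measure (V → Bool) :=
  (1 / 2 : ENNReal) • Measure.dirac (boolIndicator ∅) +
    (1 / 2 : ENNReal) • Measure.dirac (boolIndicator K)

instance (K : Set V) : IsProbabilityMeasure (twoPointMeasure K) := by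
  constructor
  simp [twoPointMeasure, ENNReal.inv_two_add_inv_two]

variable [Finite V] {K A B C : Set V}

theorem ae_twoPointMeasure {p : (V → Bool) → Prop} :
    (∀ᵐ x ∂twoPointMeasure K, p x) ↔ p (boolIndicator ∅) ∧ p (boolIndicator K) := by
  rw [twoPointMeasure, ae_add_measure_iff, Measure.ae_ennreal_smul_measure_iff (by simp),
    Measure.ae_ennreal_smul_measure_iff (by simp), ae_dirac_eq, ae_dirac_eq]
  simp

theorem integral_twoPointMeasure (f : (V → Bool) → ℝ) :
    ∫ x, f x ∂twoPointMeasure K = (f (boolIndicator ∅) + f (boolIndicator K)) / 2 := by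
  rw [twoPointMeasure, integral_add_measure (Integrable.of_finite.smul_measure (by simp))
      (Integrable.of_finite.smul_measure (by simp)),
    integral_smul_measure, integral_smul_measure, integral_dirac, integral_dirac]
  simp
  ring

/-- The distribution `twoPointMeasure K` on the space of `|V|` coins. -/
noncomputable def twoPoint (K : Set V) : ProbabilityMeasure (∀ _ : V, Bool) :=
  ⟨twoPointMeasure K, inferInstance⟩

theorem condIndepCoord_twoPoint_of_disjoint (h : Disjoint A K) :
    CondIndepCoord (twoPoint K) A B C := by
  refine condIndepFun_of_ae_eq_left (h := fun _ => A.domRestrict (boolIndicator ∅))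
    (Set.measurable_restrict A) (Set.measurable_restrict B) measurable_const ?_
  refine ae_twoPointMeasure.2 ⟨rfl, ?_⟩
  funext v
  have : (v : V) ∉ K := Set.disjoint_left.1 h v.2
  simp [boolIndicator, this]

/-- The coordinate at `u` reveals the toss, so almost surely the coordinates in `A` are a function
of those in `C`. -/
theorem condIndepCoord_twoPoint_of_mem {u : V} (huC : u ∈ C) (huK : u ∈ K) :
    CondIndepCoord (twoPoint K) A B C := by
  classical
  let φ : ((v : C) → Bool) → (v : A) → Bool := fun y v => if (v : V) ∈ K then y ⟨u, huC⟩ else false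
  have hφ : Measurable[MeasurableSpace.comap (C.domRestrict (π := fun _ : V => Bool)) inferInstance]
      fun x : V → Bool => φ (C.domRestrict x) :=
    Measurable.comp (f := C.domRestrict (π := fun _ : V => Bool)) (measurable_of_finite φ)
      (comap_measurable _)
  refine condIndepFun_of_ae_eq_left (h := fun x => φ (C.domRestrict x))
    (Set.measurable_restrict A) (Set.measurable_restrict B) hφ ?_
  refine ae_twoPointMeasure.2 ⟨?_, ?_⟩
  · funext v
    simp [φ, boolIndicator]
  · funext v
    by_cases hv : (v : V) ∈ K <;> simp [φ, boolIndicator, hv, huK]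

theorem condIndepCoord_symm {X : V → Type} [∀ v, MeasurableSpace (X v)]
    [∀ v, StandardBorelSpace (X v)] {P : ProbabilityMeasure (∀ v, X v)}
    (h : CondIndepCoord P A B C) : CondIndepCoord P B A C :=
  CondIndepFun.symm h

theorem not_condIndepCoord_twoPoint (haA : a ∈ A) (haK : a ∈ K) (hbB : b ∈ B) (hbK : b ∈ K)
    (hCK : Disjoint C K) : ¬ CondIndepCoord (twoPoint K) A B C := by
  intro h
  have hm : MeasurableSpace.comap (C.domRestrict (π := fun _ : V => Bool)) inferInstance ≤
      (inferInstance : MeasurableSpace (V → Bool)) := (Set.measurable_restrict C).comap_le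
  -- The coordinates in `C` agree on the two atoms, so a conditional expectation takes the same
  -- value at both, namely the mean. For two events and their intersection the product rule would
  -- read `1/2 = 1/2 * 1/2`.
  have key : ∀ W : Set (V → Bool), boolIndicator ∅ ∉ W → boolIndicator K ∈ W →
      ((twoPointMeasure K)[W.indicator fun _ => (1 : ℝ) |
        MeasurableSpace.comap (C.domRestrict (π := fun _ : V => Bool)) inferInstance])
        (boolIndicator ∅) = 1 / 2 := by
    intro W h0 h1
    set F := (twoPointMeasure K)[W.indicator fun _ => (1 : ℝ) |
        MeasurableSpace.comap (C.domRestrict (π := fun _ : V => Bool)) inferInstance] with hF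
    have hint : ∫ x, F x ∂twoPointMeasure K =
        ∫ x, W.indicator (fun _ => (1 : ℝ)) x ∂twoPointMeasure K := integral_condExp hm
    rw [integral_twoPointMeasure, integral_twoPointMeasure] at hint
    have hmeas : MeasurableSet[MeasurableSpace.comap
        (C.domRestrict (π := fun _ : V => Bool)) inferInstance] (F ⁻¹' {F (boolIndicator ∅)}) :=
      stronglyMeasurable_condExp.measurable (measurableSet_singleton _)
    obtain ⟨s, -, hs⟩ := hmeas
    have heq : C.domRestrict (boolIndicator K) = C.domRestrict (boolIndicator (∅ : Set V)) := by
      funext v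
      have : (v : V) ∉ K := Set.disjoint_left.1 hCK v.2
      simp [boolIndicator, this]
    have hmem : boolIndicator K ∈ F ⁻¹' {F (boolIndicator ∅)} := by
      rw [← hs, Set.mem_preimage, heq, ← Set.mem_preimage, hs]
      simp
    have hval : F (boolIndicator K) = F (boolIndicator ∅) := hmem
    rw [hval, Set.indicator_of_notMem h0, Set.indicator_of_mem h1] at hint
    linarith
  have h1 := (condIndepFun_iff_condExp_inter_preimage_eq_mul (Set.measurable_restrict A)
    (Set.measurable_restrict B)).1 h {y | y ⟨a, haA⟩ = true} {y | y ⟨b, hbB⟩ = true}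
    (Set.toFinite _).measurableSet (Set.toFinite _).measurableSet
  have h2 := (ae_twoPointMeasure.1 h1).1
  simp only [twoPoint, ProbabilityMeasure.coe_mk] at h2
  rw [key _ (by simp [boolIndicator]) (by simp [boolIndicator, haK, hbK]),
    key _ (by simp [boolIndicator]) (by simp [boolIndicator, haK]),
    key _ (by simp [boolIndicator]) (by simp [boolIndicator, hbK])] at h2
  norm_num at h2

/-- The independence can fail only if `K` meets `A` and `B` but not `C`, so only these triples need
an open route. -/
theorem twoPoint_mem_ampModel (hG : G.IsChainGraph)
    (h : ∀ A B C : Set V, Disjoint A B → Disjoint A C → Disjoint B C → ∀ a ∈ A, ∀ b ∈ B,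
      a ∈ K → b ∈ K → Disjoint C K → G.Connects A B C) :
    twoPoint K ∈ G.ampModel fun _ => Bool := by
  intro A B C hAB hAC hBC hsep
  rw [separates_iff hG hBC] at hsep
  by_cases hA : Disjoint A K
  · exact condIndepCoord_twoPoint_of_disjoint hA
  by_cases hB : Disjoint B K
  · exact condIndepCoord_symm (condIndepCoord_twoPoint_of_disjoint hB)
  by_cases hC : Disjoint C K
  · obtain ⟨a, ha, haK⟩ := Set.not_disjoint_iff.1 hA
    obtain ⟨b, hb, hbK⟩ := Set.not_disjoint_iff.1 hB
    exact absurd (h A B C hAB hAC hBC a ha b hb haK hbK hC) hsep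
  · obtain ⟨u, huC, huK⟩ := Set.not_disjoint_iff.1 hC
    exact condIndepCoord_twoPoint_of_mem huC huK

end TwoPoint

/-! ### Markov equivalence determines skeleton and triplexes -/

theorem Open.of_adj {A C : Set V} {x y : V} (hx : G.Open A C x .tail) (hxC : x ∉ C)
    (h : G.Adj x y) :
    (G.Arrow x y ∧ G.Open A C y .head) ∨ (G.Line x y ∧ G.Open A C y .line) ∨
      G.Open A C y .tail := by
  rcases adj_iff_arrow_or_line.1 h with h | h | h
  · exact Or.inl ⟨h, .out hx h hxC⟩
  · exact Or.inr (Or.inl ⟨h, .line hx h (by simp [hxC])⟩)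
  · exact Or.inr (Or.inr (.into hx h (by simp [hxC])))

theorem connects_of_adj {A B C : Set V} (ha : a ∈ A) (hb : b ∈ B) (hAC : Disjoint A C)
    (h : G.Adj a b) : G.Connects A B C := by
  rcases (Open.start ha).of_adj (Set.disjoint_left.1 hAC ha) h with h | h | h
  · exact ⟨b, hb, _, h.2⟩
  · exact ⟨b, hb, _, h.2⟩
  · exact ⟨b, hb, _, h⟩

theorem connects_of_not_triplex {A B C : Set V} (ha : a ∈ A) (hc : c ∈ B) (hAC : Disjoint A C)
    (hb : b ∉ C) (hab : G.Adj a b) (hbc : G.Adj b c) (hne : a ≠ c) (hac : ¬ G.Adj a c)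
    (ht : ¬ G.Triplex a b c) : G.Connects A B C := by
  have ht' : G.Edge a b → G.Edge c b → ¬ (G.Arrow a b ∨ G.Arrow c b) := fun h1 h2 h3 =>
    ht ⟨hne, hac, h1, h2, h3⟩
  rcases (Open.start ha).of_adj (Set.disjoint_left.1 hAC ha) hab with ⟨h, ho⟩ | ⟨h, ho⟩ | ho
  · have hcb : ¬ G.Edge c b := fun h' => ht' h.1 h' (Or.inl h)
    exact ⟨c, hc, _, .out ho ⟨hbc.resolve_right hcb, hcb⟩ hb⟩
  · rcases adj_iff_arrow_or_line.1 hbc with h' | h' | h'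
    · exact ⟨c, hc, _, .out ho h' hb⟩
    · exact ⟨c, hc, _, .line ho h' (by simp [hb])⟩
    · exact absurd (Or.inr h') (ht' h.1 h'.1)
  · rcases ho.of_adj hb hbc with h | h | h
    · exact ⟨c, hc, _, h.2⟩
    · exact ⟨c, hc, _, h.2⟩
    · exact ⟨c, hc, _, h⟩

/-- Two vertices that are dependent given every set of other vertices outside `K` in the
distribution `twoPoint K` of the model are not separated by such sets. -/
theorem not_mem_ampModel [Finite V] {K C : Set V} (hG : G.IsChainGraph) (haK : a ∈ K)
    (hcK : c ∈ K) (hne : a ≠ c) (hCK : Disjoint C K)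
    (h : ¬ G.Connects {a} {c} C ∨ ¬ G.Connects {c} {a} C) :
    twoPoint K ∉ G.ampModel fun _ => Bool := by
  have key : ∀ a c, a ∈ K → c ∈ K → a ≠ c → ¬ G.Connects {a} {c} C →
      twoPoint K ∉ G.ampModel fun _ => Bool := by
    intro a c haK hcK hne h hP
    have ha : a ∉ C := fun h => Set.disjoint_left.1 hCK h haK
    have hc : c ∉ C := fun h => Set.disjoint_left.1 hCK h hcK
    refine not_condIndepCoord_twoPoint (A := {a}) (B := {c}) rfl haK rfl hcK hCK (hP {a} {c} C (by simpa using hne)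
      (by simpa using ha) (by simpa using hc) ?_)
    exact (separates_iff hG (by simpa using hc)).2 h
  exact h.elim (key a c haK hcK hne) (key c a hcK haK hne.symm)

theorem adj_of_markovEquiv [Finite V] (hG : G.IsChainGraph) (hH : H.IsChainGraph)
    (h : MarkovEquiv G H) (hab : G.Adj a b) : H.Adj a b := by
  by_contra hn
  obtain ⟨C, haC, hbC, -, hsep⟩ := exists_separator hH hab.ne hn
  have hP : twoPoint {a, b} ∈ G.ampModel fun _ => Bool := by
    refine twoPoint_mem_ampModel hG fun A B C hAB hAC _ x hx y hy hxK hyK _ => ?_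
    have hxy : x ≠ y := fun h => Set.disjoint_left.1 hAB hx (h ▸ hy)
    refine connects_of_adj hx hy hAC ?_
    rcases hxK with rfl | rfl <;> rcases hyK with rfl | rfl
    · exact absurd rfl hxy
    · exact hab
    · exact hab.symm
    · exact absurd rfl hxy
  rw [h fun _ => Bool] at hP
  refine not_mem_ampModel hH (a := a) (c := b) (by simp) (by simp) hab.ne ?_ hsep hP
  rw [Set.disjoint_right]
  rintro x (rfl | rfl)
  · exact haC
  · exact hbC

/-- Without the triplex, in `H` the path through `b` stays open given any set that avoids `b`, so
the coin on `{a, b, c}` belongs to the model of `H`. In `G` some set without `b` separates `a` from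
`c`, which the coin violates. -/
theorem triplex_of_markovEquiv [Finite V] (hG : G.IsChainGraph) (hH : H.IsChainGraph)
    (h : MarkovEquiv G H) (hs : SameSkeleton G H) (ht : G.Triplex a b c) : H.Triplex a b c := by
  by_contra hn
  obtain ⟨C, haC, hcC, hbC, hsep⟩ := exists_separator hG ht.1 ht.2.1
  have hac : ¬ H.Adj a c := fun h' => ht.2.1 ((hs a c).2 h')
  have hab : H.Adj a b := (hs a b).1 (Edge.adj ht.2.2.1)
  have hcb : H.Adj c b := (hs c b).1 (Edge.adj ht.2.2.2.1)
  have hP : twoPoint {a, b, c} ∈ H.ampModel fun _ => Bool := by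
    refine twoPoint_mem_ampModel hH fun A B C hAB hAC _ x hx y hy hxK hyK hC => ?_
    have hxy : x ≠ y := fun h => Set.disjoint_left.1 hAB hx (h ▸ hy)
    have hb : b ∉ C := fun h => Set.disjoint_left.1 hC h (by simp)
    rcases hxK with rfl | rfl | rfl <;> rcases hyK with rfl | rfl | rfl
    · exact absurd rfl hxy
    · exact connects_of_adj hx hy hAC hab
    · exact connects_of_not_triplex hx hy hAC hb hab hcb.symm hxy hac hn
    · exact connects_of_adj hx hy hAC hab.symm
    · exact absurd rfl hxy
    · exact connects_of_adj hx hy hAC hcb.symm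
    · exact connects_of_not_triplex hx hy hAC hb hcb hab.symm hxy (fun h => hac h.symm)
        fun h => hn h.symm
    · exact connects_of_adj hx hy hAC hcb
    · exact absurd rfl hxy
  rw [← h fun _ => Bool] at hP
  refine not_mem_ampModel hG (a := a) (c := c) (by simp) (by simp) ht.1 ?_ hsep hP
  rw [Set.disjoint_right]
  rintro x (rfl | rfl | rfl)
  · exact haC
  · exact hbC _ ht
  · exact hcC

theorem MarkovEquiv.symm [Finite V] (h : MarkovEquiv G H) : MarkovEquiv H G :=
  fun X _ _ => (h X).symm

theorem MarkovEquiv.trans [Finite V] {K : MixedGraph V} (h : MarkovEquiv G H)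
    (h' : MarkovEquiv H K) : MarkovEquiv G K :=
  fun X _ _ => (h X).trans (h' X)

/-- Chain graphs are Markov equivalent iff they have the same skeleton and the same triplexes. -/
theorem markovEquiv_iff [Finite V] (hG : G.IsChainGraph) (hH : H.IsChainGraph) :
    MarkovEquiv G H ↔ TriplexEquiv G H := by
  refine ⟨fun h => ?_, markovEquiv_of_triplexEquiv hG hH⟩
  have hs : SameSkeleton G H := fun a b =>
    ⟨adj_of_markovEquiv hG hH h, adj_of_markovEquiv hH hG h.symm⟩
  exact ⟨hs, fun a b c => ⟨triplex_of_markovEquiv hG hH h hs,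
    triplex_of_markovEquiv hH hG h.symm fun a b => (hs a b).symm⟩⟩

/-! ### Markov equivalence classes and the theorem -/

theorem markovClass_eq [Finite V] {G₀ : MixedGraph V} (h : G₀.IsChainGraph) :
    {G | G.IsChainGraph ∧ MarkovEquiv G G₀} = triplexClass G₀ :=
  Set.ext fun _ => and_congr_right fun hG => markovEquiv_iff hG h

theorem IsMarkovClass.eq_of_mem [Finite V] {𝒢₁ 𝒢₂ : Set (MixedGraph V)} (h₁ : IsMarkovClass 𝒢₁)
    (h₂ : IsMarkovClass 𝒢₂) (hG₁ : G ∈ 𝒢₁) (hG₂ : G ∈ 𝒢₂) : 𝒢₁ = 𝒢₂ := by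
  obtain ⟨H₁, -, rfl⟩ := h₁
  obtain ⟨H₂, -, rfl⟩ := h₂
  have h := hG₁.2.symm.trans hG₂.2
  exact Set.ext fun K => and_congr_right fun _ => ⟨fun hK => hK.trans h, fun hK => hK.trans h.symm⟩

theorem IsMarkovClass.essentialGraph_mem [Finite V] {𝒢 : Set (MixedGraph V)}
    (h : IsMarkovClass 𝒢) : essentialGraph 𝒢 ∈ 𝒢 := by
  obtain ⟨G₀, hG₀, rfl⟩ := h
  rw [markovClass_eq hG₀]
  exact MixedGraph.essentialGraph_mem ⟨hG₀, TriplexEquiv.refl G₀⟩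

end MixedGraph

theorem theorem3p2 {V : Type*} [Finite V] :
    (∀ 𝒢 : Set (MixedGraph V), MixedGraph.IsMarkovClass 𝒢 →
      (∀ G ∈ 𝒢, MixedGraph.SameSkeleton (MixedGraph.essentialGraph 𝒢) G) ∧
      (MixedGraph.essentialGraph 𝒢).IsChainGraph ∧
      MixedGraph.essentialGraph 𝒢 ∈ 𝒢 ∧
      ∀ G ∈ 𝒢, MixedGraph.MarkovEquiv (MixedGraph.essentialGraph 𝒢) G) ∧
    ∀ 𝒢₁ 𝒢₂ : Set (MixedGraph V), MixedGraph.IsMarkovClass 𝒢₁ → MixedGraph.IsMarkovClass 𝒢₂ →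
      (𝒢₁ = 𝒢₂ ↔ MixedGraph.essentialGraph 𝒢₁ = MixedGraph.essentialGraph 𝒢₂) := by
  refine ⟨fun 𝒢 h𝒢 => ?_, fun 𝒢₁ 𝒢₂ h₁ h₂ => ⟨fun h => h ▸ rfl, fun h => ?_⟩⟩
  · have hmem := h𝒢.essentialGraph_mem
    obtain ⟨G₀, hG₀, rfl⟩ := h𝒢
    have hequiv := fun G (hG : G ∈ {G | G.IsChainGraph ∧ MixedGraph.MarkovEquiv G G₀}) =>
      hmem.2.trans hG.2.symm
    exact ⟨fun G hG => ((MixedGraph.markovEquiv_iff hmem.1 hG.1).1 (hequiv G hG)).1, hmem.1, hmem,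
      hequiv⟩
  · exact h₁.eq_of_mem h₂ h₁.essentialGraph_mem (h ▸ h₂.essentialGraph_mem)
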